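/- Let $n\ge 0$ and let $S_n$ be the group of permutations $w=w_1\cdots w_n$ of $\{1,\dots,n\}$, with product $(uv)_i=u_{v_i}$, transpositions $s_{ij}$, longest element $w_\circ=n,n-1,\dots,1$, and length $\ell(w)$ equal to the number of inversions. For $\sigma\in S_r$, $w$ is called $\sigma$-avoiding if no $i_1<\dots<i_r$ are such that $w_{i_1},\dots,w_{i_r}$ have the same relative order as $\sigma_1,\dots,\sigma_r$; $2143$-avoiding permutations are called vexillary. In the Bruhat order $u\lessdot v$ means that $v=u\,s_{ij}$ for some $i<j$ and $\ell(v)=\ell(u)+1$; put $m(u,u s_{ij})=y_i-y_j$ in this case. Define $$\mathfrak{D}_w(y_1,\dots,y_n)=\frac1{\ell(w)!}\sum_{C}\ \prod_{k=1}^{l} m(u_{k-1},u_k)\in\mathbb{Q}[y_1,\dots,y_n],$$ the sum over all saturated chains $C=(u_0\lessdot u_1\lessdot\cdots\lessdot u_l)$ from $u_0=\mathrm{id}$ to $u_l=w$ (so $l=\ell(w)$). For $v\in S_n$ let $\mathrm{Inv}_i(v)=\{j>i\mid v_j<v_i\}$ and $\mathrm{code}(v)=(c_1,\dots,c_n)$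 with $c_i=|\mathrm{Inv}_i(v)|$. The shape of $v$ is the partition formed by the nonzero $c_i$ in decreasing order, and the flag of $v$ is the sequence of the numbers $\min\mathrm{Inv}_i(v)-1$, for $i$ with $\mathrm{Inv}_i(v)\neq\emptyset$, in increasing order. For a partition $\mu=(\mu_1\ge\dots\ge\mu_m)$ and $b=(b_1\le\dots\le b_m)$, the flagged Schur polynomial is $s_\mu^b(x)=\sum_T x^T$, over all semistandard Young tableaux $T$ of shape $\mu$ with positive integer entries such that all entries of row $i$ are at most $b_i$, for $i=1,\dots,m$; here $x^T$ is the product of $x_t$ over all entries $t$ of $T$. **Theorem.** Let $w\in S_n$ be $3412$-avoiding. Then $w_\circ w$ is vexillary and, with $\mu$ and $b$ the shape and the flag of $w_\circ w$, $$\mathfrak{D}_w(y_1,\dots,y_n)=\frac{1}{1!\,2!\cdots(n-1)!}\; s_\mu^b\!\left(\frac{\partial}{\partial y_1},\dots,\frac{\partial}{\partial y_n}\right)\cdot\prod_{1\le i<j\le n}(y_i-y_j).$$ If $w\in S_n$ is $312$-avoiding and $(c_1,\dots,c_n)=\mathrm{code}(w_\circ w)$, then $$\mathfrak{D}_w(y_1,\dots,y_n)=\frac{1}{1!\,2!\cdots(n-1)!}\left(\prod_{k=1}^n\Big(\frac{\partial}{\partial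 y_k}\Big)^{c_k}\right)\cdot\prod_{1\le i<j\le n}(y_i-y_j)=\det\left(\left(y_i^{(n-c_i-j)}\right)_{i,j=1}^n\right),$$ where $a^{(b)}=a^b/b!$ for $b\ge 0$ and $a^{(b)}=0$ for $b<0$. -/

import Mathlib

noncomputable section

namespace DegPoly

variable {n : ℕ}

/-! Throughout, a permutation `w ∈ S_n` is a `w : Equiv.Perm (Fin n)`; positions and values are
numbered `0, …, n - 1`, and the product `u * v` is the composition `i ↦ u (v i)`. -/

/-! ### Permutations: inversions, patterns, code, shape and flag -/

/-- `w` avoids the pattern `σ = σ₁ ⋯ σ_r` (a word with distinct letters): no `r` positions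
`i₁ < ⋯ < i_r` carry values of `w` in the same relative order as `σ₁, …, σ_r`. -/
def Avoids {r : ℕ} (w : Equiv.Perm (Fin n)) (σ : Fin r → ℕ) : Prop :=
  ¬ ∃ f : Fin r ↪o Fin n, ∀ a b : Fin r, w (f a) < w (f b) ↔ σ a < σ b

/-- A permutation is vexillary if it is `2143`-avoiding. -/
def IsVexillary (w : Equiv.Perm (Fin n)) : Prop := Avoids w ![2, 1, 4, 3]

/-- The longest permutation `n, n - 1, …, 1`. -/
def longest (n : ℕ) : Equiv.Perm (Fin n) := Fin.revPerm

/-- The inversion set `Inv_i(w) = {j > i ∣ w_j < w_i}`. -/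
def invSet (w : Equiv.Perm (Fin n)) (i : Fin n) : Finset (Fin n) :=
  Finset.univ.filter fun j => i < j ∧ w j < w i

/-- The code of a permutation, `c_i = #Inv_i(w)`. -/
def code (w : Equiv.Perm (Fin n)) (i : Fin n) : ℕ := (invSet w i).card

/-- The length of a permutation: its number of inversions. -/
def length (w : Equiv.Perm (Fin n)) : ℕ :=
  (Finset.univ.filter fun p : Fin n × Fin n => p.1 < p.2 ∧ w p.2 < w p.1).card

/-- The nonzero components of the code, arranged in decreasing order. -/
def shapeList (w : Equiv.Perm (Fin n)) : List ℕ :=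
  (((Finset.univ : Finset (Fin n)).val.map (code w)).filter (0 < ·)).sort (· ≥ ·)

theorem shapeList_sortedGE (w : Equiv.Perm (Fin n)) : (shapeList w).SortedGE :=
  (Multiset.pairwise_sort _ _).sortedGE

/-- The shape of a permutation, the partition with the parts `shapeList w`,
as a Young diagram. -/
def shape (w : Equiv.Perm (Fin n)) : YoungDiagram :=
  YoungDiagram.ofRowLens (shapeList w) (shapeList_sortedGE w)

/-- The flag of a permutation: the numbers `min Inv_i(w) - 1`, over the non-empty `Inv_i(w)`,
arranged in increasing order. Here `min Inv_i(w)` refers to positions numbered from `1`, so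
`min Inv_i(w) - 1` is the least element of `invSet w i` as a number in `0, …, n - 1`. -/
def flag (w : Equiv.Perm (Fin n)) : List ℕ :=
  ((Finset.univ.filter fun i : Fin n => (invSet w i).Nonempty).val.map
    fun i => sInf {k : ℕ | ∃ j ∈ invSet w i, (j : ℕ) = k}).sort (· ≤ ·)

/-! ### The polynomials `𝔇_{u,w}` -/

/-- The covering relation of the Bruhat order: `v = u s_{ij}` and `ℓ(v) = ℓ(u) + 1`. -/
def Covers (u v : Equiv.Perm (Fin n)) : Prop :=
  (∃ i j : Fin n, i < j ∧ v = u * Equiv.swap i j) ∧ length v = length u + 1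

/-- The Chevalley multiplicity `m(u, u s_{ij}) = y_i - y_j`, `i < j`, of a covering relation.
If `u ⋖ v` then exactly one pair `(i, j)` contributes to the sum. -/
def edgeWeight (u v : Equiv.Perm (Fin n)) : MvPolynomial (Fin n) ℚ :=
  ∑ p ∈ Finset.univ.filter (fun p : Fin n × Fin n => p.1 < p.2 ∧ v = u * Equiv.swap p.1 p.2),
    (MvPolynomial.X p.1 - MvPolynomial.X p.2)

open Classical in
/-- The saturated chains `u = u₀ ⋖ u₁ ⋖ ⋯ ⋖ u_l = w` of length `l` in the Bruhat order. -/
def satChains (u w : Equiv.Perm (Fin n)) (l : ℕ) : Finset (Fin (l + 1) → Equiv.Perm (Fin n)) :=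
  Finset.univ.filter fun C =>
    C 0 = u ∧ C (Fin.last l) = w ∧ ∀ i : Fin l, Covers (C i.castSucc) (C i.succ)

/-- `𝔇_{u,w} = 1 / (ℓ(w) - ℓ(u))! · ∑_C m_C(y)`, the sum over all saturated chains from `u` to `w`
(which all have length `ℓ(w) - ℓ(u)`), where `m_C` is the product of the Chevalley
multiplicities along `C`. -/
def degPoly₂ (u w : Equiv.Perm (Fin n)) : MvPolynomial (Fin n) ℚ :=
  MvPolynomial.C (1 / ((length w - length u).factorial : ℚ)) *
    ∑ C ∈ satChains u w (length w - length u),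
      ∏ i : Fin (length w - length u), edgeWeight (C i.castSucc) (C i.succ)

/-- `𝔇_w = 𝔇_{id,w}`. -/
def degPoly (w : Equiv.Perm (Fin n)) : MvPolynomial (Fin n) ℚ := degPoly₂ 1 w

/-! ### Flagged Schur polynomials -/

/-- The flagged semistandard tableaux of shape `μ` with flag `b = (b₁, b₂, …)`: each entry of
row `i` is at most `b_i`. In Mathlib's semistandard tableaux the entries are numbered from `0`,
so the entry `t` stands for the positive integer `t + 1`. -/
def flaggedSet (μ : YoungDiagram) (b : List ℕ) : Set (SemistandardYoungTableau μ) :=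
  {T | ∀ i j : ℕ, (i, j) ∈ μ → T i j + 1 ≤ b.getD i 0}

theorem flaggedSet_finite (μ : YoungDiagram) (b : List ℕ) : (flaggedSet μ b).Finite := by
  classical
  have hfin : {f : μ.cells → ℕ | ∀ c, f c ∈ Set.Iic (b.getD c.1.1 0)}.Finite :=
    Set.Finite.pi' fun c => Set.finite_Iic _
  refine Set.Finite.of_finite_image
    (f := fun (T : SemistandardYoungTableau μ) (c : μ.cells) => T c.1.1 c.1.2)
    (hfin.subset ?_) ?_
  · rintro _ ⟨T, hT, rfl⟩ c
    exact (Nat.le_succ _).trans (hT c.1.1 c.1.2 c.2)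
  · intro T _ T' _ h
    ext i j
    by_cases hc : (i, j) ∈ μ
    · exact congrFun h ⟨(i, j), hc⟩
    · rw [T.zeros hc, T'.zeros hc]

/-- The flagged Schur polynomial `s_μ^b ∈ ℚ[x₁, x₂, …]`, the sum of `x^T` over all flagged
semistandard tableaux `T` of shape `μ` with flag `b`.
The variable `X k` of `MvPolynomial ℕ ℚ` is `x_{k+1}`. -/
def flaggedSchur (μ : YoungDiagram) (b : List ℕ) : MvPolynomial ℕ ℚ :=
  ∑ T ∈ (flaggedSet_finite μ b).toFinset, ∏ c ∈ μ.cells, MvPolynomial.X (T c.1 c.2)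

/-! ### Differential operators, Vandermonde product, divided powers -/

/-- The operator `(∂/∂y₁)^{m₁} ⋯ (∂/∂y_n)^{m_n}` on `ℚ[y₁, …, y_n]`. -/
def partialMonomial (m : Fin n → ℕ) : Module.End ℚ (MvPolynomial (Fin n) ℚ) :=
  (List.ofFn fun k : Fin n =>
    ((MvPolynomial.pderiv k).toLinearMap : Module.End ℚ (MvPolynomial (Fin n) ℚ)) ^ m k).prod

/-- The operator `f(∂/∂y₁, …, ∂/∂y_n)` on `ℚ[y₁, …, y_n]`. -/
def diffOp (f : MvPolynomial (Fin n) ℚ) : Module.End ℚ (MvPolynomial (Fin n) ℚ) :=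
  ∑ m ∈ f.support, f.coeff m • partialMonomial m

/-- A polynomial in `x₁, x₂, …` as a polynomial in `x₁, …, x_n`
(the variables `x_k` with `k > n` are set to `0`). -/
def toFin (n : ℕ) (f : MvPolynomial ℕ ℚ) : MvPolynomial (Fin n) ℚ :=
  MvPolynomial.killCompl (f := (Fin.val : Fin n → ℕ)) Fin.val_injective f

/-- The product `∏_{i<j} (y_i - y_j)`. -/
def vandermondeProd (n : ℕ) : MvPolynomial (Fin n) ℚ :=
  ∏ i : Fin n, ∏ j ∈ Finset.Ioi i, (MvPolynomial.X i - MvPolynomial.X j)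

/-- The number `1! 2! ⋯ (n-1)!`. -/
def factProd (n : ℕ) : ℚ := ∏ k ∈ Finset.range n, (k.factorial : ℚ)

/-- `a^{(b)} = a^b / b!` for `b ≥ 0` and `a^{(b)} = 0` for `b < 0`. -/
def divPow (a : MvPolynomial (Fin n) ℚ) (b : ℤ) : MvPolynomial (Fin n) ℚ :=
  if 0 ≤ b then MvPolynomial.C (1 / (b.toNat.factorial : ℚ)) * a ^ b.toNat else 0

end DegPoly

end

noncomputable section

namespace DegPoly

variable {n : ℕ}

open Equiv Finset
open MvPolynomial (X C pderiv rename coeff)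

/-! ### Lengths and covers -/

/-! The polynomials `degPoly w` are dual to Schubert polynomials, and the proof transposes the
combinatorics of Schubert polynomials into statements about derivatives. A function on `S_n` is read
as a list of coefficients in the Schubert basis. `monkOp` is then multiplication by a variable,
given by Monk's formula truncated to `S_n`, and `divDiff` is a divided difference. No Schubert
polynomial is constructed: the twisted Leibniz rule `divDiff_mul_monkOp` is checked on covers, and
it implies by induction on degree that the operators `monkOp` commute (`monkOp_comm`). Splitting off
the last step of a chain gives an Euler identity (`degPoly_euler`). Differentiating it and using
commutativity yields `pderiv_degPoly`: a partial derivative of `degPoly` is the corresponding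
`monkOp` applied to `degPoly`.

Written for `codegPoly v = degPoly (longest n * v)`, this becomes the transition formula of Lascoux
and Schützenberger (`codegPoly_transition`) with multiplication by `x_r` replaced by `∂/∂y_r`.
Repeated transitions express every polynomial concerned as a differential operator applied to
`degPoly (longest n)`. If `v` avoids 132, the additional terms vanish and the operator is the
monomial with exponent `code v` (`codegPoly_of_dominant`). If `v` is vexillary, there is at most one
additional term, and flagged tableaux satisfy the same recursion (`tabPoly_transition`): either the
corner cell that belongs to the last descent `r` contains the largest possible entry, and is
removed, or its entry is smaller, which is precisely the flag condition after the transition.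

Finally, `degPoly (longest n)` is antisymmetric, because it is so under every adjacent transposition
at a descent, and homogeneous of the degree of the Vermonde product. Hence it is determined by one
coefficient, which the 132-avoiding case with `v = longest n` supplies (`degPoly_longest`). -/

theorem length_mul_swap_of_lt (w : Perm (Fin n)) {i j : Fin n} (hij : i < j) (hw : w i < w j) :
    length (w * swap i j) =
      length w + 1 + 2 * #{k ∈ Ioo i j | w i < w k ∧ w k < w j} := by
  classical
  set s := swap i j with hs
  -- Relabelling pairs by `s` gives the inversions of `w * s` the same value condition as those of
  -- `w`; only the order condition on positions differs.
  have h1 : length (w * s) = #{p : Fin n × Fin n | s p.1 < s p.2 ∧ w p.2 < w p.1} := by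
    unfold length
    refine Finset.card_bij' (fun p _ => (s p.1, s p.2)) (fun p _ => (s p.1, s p.2)) ?_ ?_ ?_ ?_ <;>
      simp [hs]
  have hsi : s i = j := by simp [hs]
  have hsj : s j = i := by simp [hs]
  have hsk : ∀ k, k ≠ i → k ≠ j → s k = k := fun k h h' => swap_apply_of_ne_of_ne h h'
  set K := Ioo i j with hK
  -- In relabelled form, `Dm` collects the inversions lost and `Dp` those gained. Apart from `(j,
  -- i)` they all pair an end of the interval with a position strictly inside it.
  set Dm : Finset (Fin n × Fin n) := {i} ×ˢ {k ∈ K | w k < w i} ∪ {k ∈ K | w j < w k} ×ˢ {j}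
  set Dp : Finset (Fin n × Fin n) :=
    {k ∈ K | w i < w k} ×ˢ {i} ∪ ({j} ×ˢ {k ∈ K | w k < w j} ∪ {(j, i)})
  have hm : ({p : Fin n × Fin n | p.1 < p.2 ∧ w p.2 < w p.1} : Finset _) \
      ({p : Fin n × Fin n | s p.1 < s p.2 ∧ w p.2 < w p.1} : Finset _) = Dm := by
    ext ⟨p, q⟩
    simp only [Dm, mem_sdiff, mem_filter, mem_univ, true_and, mem_union, mem_product,
      mem_singleton, hK, mem_Ioo]
    by_cases p1 : p = i <;> by_cases p2 : p = j <;> by_cases q1 : q = i <;> by_cases q2 : q = j <;>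
      grind
  have hp : ({p : Fin n × Fin n | s p.1 < s p.2 ∧ w p.2 < w p.1} : Finset _) \
      ({p : Fin n × Fin n | p.1 < p.2 ∧ w p.2 < w p.1} : Finset _) = Dp := by
    ext ⟨p, q⟩
    simp only [Dp, mem_sdiff, mem_filter, mem_univ, true_and, mem_union, mem_product,
      mem_singleton, hK, mem_Ioo, Prod.mk.injEq]
    by_cases p1 : p = i <;> by_cases p2 : p = j <;> by_cases q1 : q = i <;> by_cases q2 : q = j <;>
      grind
  have hDm : #Dm = #{k ∈ K | w k < w i} + #{k ∈ K | w j < w k} := by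
    rw [card_union_of_disjoint, card_product, card_product]
    · simp
    · rw [Finset.disjoint_left]
      rintro ⟨a, b⟩; simp [hK]
      grind
  have hDp : #Dp = #{k ∈ K | w i < w k} + (#{k ∈ K | w k < w j} + 1) := by
    rw [card_union_of_disjoint, card_union_of_disjoint, card_product, card_product]
    · simp
    · rw [Finset.disjoint_left]
      rintro ⟨a, b⟩; simp [hK]
      grind
    · rw [Finset.disjoint_left]
      rintro ⟨a, b⟩; simp [hK]
      grind
  have e1 : #{k ∈ K | w k < w i} + #{k ∈ K | w i < w k} = #K := by
    rw [← card_filter_add_card_filter_not (s := K) (fun k => w k < w i)]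
    congr 2
    ext k
    have : k ∈ K → w k ≠ w i := by
      intro h; rw [hK, mem_Ioo] at h; simp; grind
    simp; grind
  have e2 : #{k ∈ K | w k < w j} + #{k ∈ K | w j < w k} = #K := by
    rw [← card_filter_add_card_filter_not (s := K) (fun k => w k < w j)]
    congr 2
    ext k
    have : k ∈ K → w k ≠ w j := by
      intro h; rw [hK, mem_Ioo] at h; simp; grind
    simp; grind
  have e3 : #{k ∈ K | w i < w k} = #{k ∈ K | w i < w k ∧ w k < w j} + #{k ∈ K | w j < w k} := by
    rw [← card_filter_add_card_filter_not (s := {k ∈ K | w i < w k}) (fun k => w k < w j),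
      filter_filter, filter_filter]
    congr 2
    ext k
    have : k ∈ K → w k ≠ w j := by
      intro h; rw [hK, mem_Ioo] at h; simp; grind
    simp; grind
  have c1 := card_sdiff_add_card_inter ({p : Fin n × Fin n | p.1 < p.2 ∧ w p.2 < w p.1} : Finset _)
      ({p : Fin n × Fin n | s p.1 < s p.2 ∧ w p.2 < w p.1} : Finset _)
  have c2 := card_sdiff_add_card_inter ({p : Fin n × Fin n | s p.1 < s p.2 ∧ w p.2 < w p.1} : Finset _)
    ({p : Fin n × Fin n | p.1 < p.2 ∧ w p.2 < w p.1} : Finset _)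
  rw [inter_comm] at c2
  rw [hm] at c1
  rw [hp] at c2
  rw [h1]
  unfold length
  omega

theorem length_mul_swap_iff (w : Perm (Fin n)) {i j : Fin n} (hij : i < j) :
    length w = length (w * swap i j) + 1 ↔
      w j < w i ∧ ∀ k, i < k → k < j → ¬ (w j < w k ∧ w k < w i) := by
  rcases lt_or_gt_of_ne (w.injective.ne hij.ne) with h | h
  · have := length_mul_swap_of_lt w hij h
    constructor
    · intro h'; omega
    · intro h'; exact absurd h'.1 h.asymm
  · have := length_mul_swap_of_lt (w * swap i j) hij (by simpa using h)
    rw [mul_assoc, swap_mul_self, mul_one] at this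
    rw [this]
    simp only [h, true_and]
    have hc : (#{k ∈ Ioo i j | (w * swap i j) i < (w * swap i j) k ∧
        (w * swap i j) k < (w * swap i j) j} = 0) ↔
        ∀ k, i < k → k < j → ¬ (w j < w k ∧ w k < w i) := by
      rw [card_eq_zero, filter_eq_empty_iff]
      refine forall_congr' fun k => ?_
      rw [mem_Ioo]
      constructor
      · intro h h1 h2
        have := h ⟨h1, h2⟩
        rwa [Perm.mul_apply, Perm.mul_apply, Perm.mul_apply,
          swap_apply_of_ne_of_ne h1.ne' h2.ne, swap_apply_left, swap_apply_right] at this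
      · intro h h1
        have := h h1.1 h1.2
        rwa [Perm.mul_apply, Perm.mul_apply, Perm.mul_apply,
          swap_apply_of_ne_of_ne h1.1.ne' h1.2.ne, swap_apply_left, swap_apply_right]
    rw [← hc]
    omega

theorem length_mul_swap_up_iff (w : Perm (Fin n)) {i j : Fin n} (hij : i < j) :
    length (w * swap i j) = length w + 1 ↔
      w i < w j ∧ ∀ k, i < k → k < j → ¬ (w i < w k ∧ w k < w j) := by
  have := length_mul_swap_iff (w * swap i j) hij
  rw [mul_assoc, swap_mul_self, mul_one] at this
  rw [this, Perm.mul_apply, Perm.mul_apply, swap_apply_left, swap_apply_right]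
  refine and_congr_right fun _ => forall_congr' fun k => forall_congr' fun h1 =>
    forall_congr' fun h2 => ?_
  rw [Perm.mul_apply, swap_apply_of_ne_of_ne h1.ne' h2.ne]

theorem length_mul_adjacent_of_lt (w : Perm (Fin n)) {k k' : Fin n} (hk : (k : ℕ) + 1 = k')
    (h : w k < w k') : length (w * swap k k') = length w + 1 := by
  rw [length_mul_swap_up_iff _ (by rw [Fin.lt_def]; omega)]
  refine ⟨h, fun j h1 h2 => ?_⟩
  rw [Fin.lt_def] at h1 h2; omega

theorem length_mul_adjacent_of_gt (w : Perm (Fin n)) {k k' : Fin n} (hk : (k : ℕ) + 1 = k')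
    (h : w k' < w k) : length w = length (w * swap k k') + 1 := by
  rw [length_mul_swap_iff _ (by rw [Fin.lt_def]; omega)]
  refine ⟨h, fun j h1 h2 => ?_⟩
  rw [Fin.lt_def] at h1 h2; omega

theorem length_one : length (1 : Perm (Fin n)) = 0 := by
  unfold length
  rw [card_eq_zero, filter_eq_empty_iff]
  rintro ⟨a, b⟩ - ⟨h1, h2⟩
  exact h1.asymm h2

theorem exists_descent {w : Perm (Fin n)} (hw : w ≠ 1) :
    ∃ k k' : Fin n, (k : ℕ) + 1 = k' ∧ w k' < w k := by
  by_contra! h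
  apply hw
  have hm : StrictMono w := by
    cases n with
    | zero => intro a; exact a.elim0
    | succ m =>
      rw [Fin.strictMono_iff_lt_succ]
      intro i
      refine lt_of_le_of_ne (h i.castSucc i.succ (by simp)) ?_
      exact w.injective.ne (Fin.castSucc_lt_succ).ne
  ext i
  have := StrictMono.range_inj hm (strictMono_id)
  simp [w.surjective.range_eq] at this
  simp [this]

/-- Cover with an ascent at `k` below a permutation with a descent at `k`. -/
theorem eq_adjacent_of_cover {w : Perm (Fin n)} {k k' i j : Fin n} (hk : (k : ℕ) + 1 = k')
    (hw : w k' < w k) (hij : i < j) (hl : length w = length (w * swap i j) + 1)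
    (ha : (w * swap i j) k < (w * swap i j) k') : i = k ∧ j = k' := by
  rw [length_mul_swap_iff _ hij] at hl
  obtain ⟨h1, h2⟩ := hl
  simp only [Perm.mul_apply] at ha
  by_cases e1 : i = k
  · subst e1
    by_cases e2 : j = k'
    · exact ⟨rfl, e2⟩
    · exfalso
      have hk' : k' < j := by
        rw [Fin.lt_def] at hij ⊢; have : (j : ℕ) ≠ k' := fun h => e2 (Fin.ext h); omega
      rw [swap_apply_left, swap_apply_of_ne_of_ne (by rw [Ne, Fin.ext_iff]; omega) hk'.ne] at ha
      exact h2 k' (by rw [Fin.lt_def]; omega) hk' ⟨ha, hw⟩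
  · exfalso
    by_cases e2 : j = k'
    · subst e2
      have hk' : i < k := by
        rw [Fin.lt_def] at hij ⊢; have : (i : ℕ) ≠ k := fun h => e1 (Fin.ext h); omega
      rw [swap_apply_right, swap_apply_of_ne_of_ne hk'.ne' (by rw [Ne, Fin.ext_iff]; omega)] at ha
      exact h2 k hk' (by rw [Fin.lt_def]; omega) ⟨hw, ha⟩
    · by_cases e3 : i = k'
      · subst e3
        rw [swap_apply_left, swap_apply_of_ne_of_ne (by rw [Ne, Fin.ext_iff]; omega)
          (by rw [Ne, Fin.ext_iff]; rw [Fin.lt_def] at hij; omega)] at ha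
        exact (ha.trans h1).asymm hw
      · by_cases e4 : j = k
        · subst e4
          rw [swap_apply_right, swap_apply_of_ne_of_ne (Ne.symm e3)
            (by rw [Ne, Fin.ext_iff]; omega)] at ha
          exact (h1.trans ha).asymm hw
        · rw [swap_apply_of_ne_of_ne (Ne.symm e1) (Ne.symm e4),
            swap_apply_of_ne_of_ne (Ne.symm e3) (Ne.symm e2)] at ha
          exact ha.asymm hw

/-! ### Monk operators and divided differences -/

section Operators
variable {R : Type*} [CommRing R]

/-- The operator of multiplication by `x_l` in the Schubert basis, restricted to `S_n`. -/
def monkOp (R : Type*) [CommRing R] (l : Fin n) : Module.End R (Perm (Fin n) → R) where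
  toFun F w := ∑ j, if length w = length (w * swap l j) + 1 then
    (if l < j then F (w * swap l j) else -F (w * swap l j)) else 0
  map_add' F G := by
    funext w
    simp only [Pi.add_apply, ← sum_add_distrib]
    refine sum_congr rfl fun j _ => ?_
    split_ifs <;> ring
  map_smul' c F := by
    funext w
    simp only [Pi.smul_apply, smul_eq_mul, mul_sum, RingHom.id_apply]
    refine sum_congr rfl fun j _ => ?_
    split_ifs <;> ring

theorem monkOp_apply (l : Fin n) (F : Perm (Fin n) → R) (w : Perm (Fin n)) :
    monkOp R l F w = ∑ j, if length w = length (w * swap l j) + 1 then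
      (if l < j then F (w * swap l j) else -F (w * swap l j)) else 0 := rfl

/-- The divided difference in the Schubert basis. -/
def divDiff (R : Type*) [CommRing R] (k k' : Fin n) : Module.End R (Perm (Fin n) → R) where
  toFun F w := if w k < w k' then F (w * swap k k') else 0
  map_add' F G := by
    funext w
    simp only [Pi.add_apply]
    split_ifs <;> simp
  map_smul' c F := by
    funext w
    simp only [Pi.smul_apply, smul_eq_mul, RingHom.id_apply]
    split_ifs <;> simp

theorem divDiff_apply (k k' : Fin n) (F : Perm (Fin n) → R) (w : Perm (Fin n)) :
    divDiff R k k' F w = if w k < w k' then F (w * swap k k') else 0 := rfl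

/-- The coefficient of `x_l` in `x_k - x_{k'}`. -/
def rootCoeff (R : Type*) [CommRing R] (k k' l : Fin n) : R :=
  if l = k then 1 else if l = k' then -1 else 0

theorem eq_adjacent_of_cover' {w : Perm (Fin n)} {k k' i j : Fin n} (hk : (k : ℕ) + 1 = k')
    (hw : w k' < w k) (hl : length w = length (w * swap i j) + 1)
    (ha : (w * swap i j) k < (w * swap i j) k') : (i = k ∧ j = k') ∨ (i = k' ∧ j = k) := by
  rcases lt_trichotomy i j with h | h | h
  · exact Or.inl (eq_adjacent_of_cover hk hw h hl ha)
  · subst h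
    rw [swap_self] at hl
    change length w = length (w * 1) + 1 at hl
    rw [mul_one] at hl
    omega
  · rw [swap_comm] at hl ha
    exact Or.inr (eq_adjacent_of_cover hk hw h hl ha).symm

theorem swap_adjacent_lt {k k' l j : Fin n} (hk : (k : ℕ) + 1 = k')
    (h1 : ¬ (l = k ∧ j = k')) (h2 : ¬ (l = k' ∧ j = k)) :
    swap k k' l < swap k k' j ↔ l < j := by
  have e : ∀ x, (swap k k' x : ℕ) = if (x : ℕ) = k then (k' : ℕ) else if (x : ℕ) = k' then k else x := by
    intro x
    rw [swap_apply_def]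
    simp only [Fin.ext_iff]
    split_ifs <;> rfl
  rw [Fin.lt_def, Fin.lt_def, e, e]
  simp only [Fin.ext_iff] at h1 h2
  split_ifs <;> omega

/-- This is the twisted Leibniz rule for a divided difference and a variable. Conjugation by the
adjacent transposition matches the covers on the two sides one by one. The match fails only for the
cover that is this transposition itself, by `eq_adjacent_of_cover'`, and this exception produces the
constant term. -/
theorem divDiff_mul_monkOp {k k' : Fin n} (hk : (k : ℕ) + 1 = k') (l : Fin n) :
    divDiff R k k' * monkOp R l =
      monkOp R (swap k k' l) * divDiff R k k' + rootCoeff R k k' l • 1 := by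
  apply LinearMap.ext
  intro F
  funext w
  set s := swap k k' with hs
  have hss : s * s = 1 := swap_mul_self _ _
  have hkk : k ≠ k' := by rw [Ne, Fin.ext_iff]; omega
  simp only [Module.End.mul_apply, LinearMap.add_apply, LinearMap.smul_apply, Module.End.one_apply,
    Pi.add_apply, Pi.smul_apply, smul_eq_mul, monkOp_apply]
  rw [divDiff_apply]
  -- The constant term is spread over the summation index, at the only `j` for which `{l, j} = {k,
  -- k'}`. After reindexing one side by `s`, the identity holds term by term.
  set corr : Fin n → R := fun j =>
    if l = k ∧ j = k' then F w else if l = k' ∧ j = k then -F w else 0 with hcorr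
  have hc : rootCoeff R k k' l * F w = ∑ j, corr j := by
    unfold rootCoeff
    rw [hcorr]
    by_cases h : l = k
    · simp [h, hkk]
    · by_cases h' : l = k'
      · simp [h', hkk.symm]
      · simp [h, h']
  rw [hc, ← Equiv.sum_comp s, ← sum_add_distrib]
  have hl : (if w k < w k' then monkOp R l F (w * swap k k') else 0) =
    ∑ j, if w k < w k' then (if length (w * s) = length (w * s * swap l j) + 1 then
      (if l < j then F (w * s * swap l j) else -F (w * s * swap l j)) else 0) else 0 := by
    rw [monkOp_apply]
    split_ifs <;> simp [hs]
  rw [hl]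
  refine sum_congr rfl fun j _ => ?_
  have hz : w * swap (s l) (s j) = w * s * swap l j * s := by
    rw [swap_apply_apply]
    have : s⁻¹ = s := swap_inv _ _
    rw [this]; simp only [mul_assoc]
  have hzs : w * swap (s l) (s j) * s = w * s * swap l j := by
    rw [hz, mul_assoc _ s s, hss, mul_one]
  rw [divDiff_apply, ← hs, hzs]
  set z := w * swap (s l) (s j) with hzdef
  by_cases hw : w k < w k'
  · rw [if_pos hw]
    have hws := length_mul_adjacent_of_lt w hk hw
    rw [← hs] at hws
    by_cases c1 : l = k ∧ j = k'
    · have hz' : z = w * s := by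
        rw [hzdef, c1.1, c1.2, hs, swap_apply_left, swap_apply_right, swap_comm]
      rw [← hzs, hz', mul_assoc, hss, mul_one, if_pos (by omega)]
      have : l < j := by rw [c1.1, c1.2, Fin.lt_def]; omega
      rw [if_pos this, if_neg (by omega)]
      simp [hcorr, c1]
    · by_cases c2 : l = k' ∧ j = k
      · have hz' : z = w * s := by
          rw [hzdef, c2.1, c2.2, hs, swap_apply_left, swap_apply_right]
        rw [← hzs, hz', mul_assoc, hss, mul_one, if_pos (by omega)]
        have : ¬ l < j := by rw [c2.1, c2.2, Fin.lt_def]; omega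
        rw [if_neg this, if_neg (by omega)]
        simp [hcorr, c2, hkk.symm]
      · have hc0 : corr j = 0 := by simp only [hcorr]; rw [if_neg c1, if_neg c2]
        rw [hc0, add_zero]
        have hlt := swap_adjacent_lt hk c1 c2
        rw [← hs] at hlt
        simp only [hlt]
        have hzk : z k = (z * s) k' := by simp [hs]
        have hzk' : z k' = (z * s) k := by simp [hs]
        by_cases hcov : length (w * s) = length (w * s * swap l j) + 1
        · have hzz : z k < z k' := by
            by_contra hcon
            have := eq_adjacent_of_cover' hk (w := w * s) (by simpa [hs] using hw) hcov (by
              rw [← hzs, ← hzk, ← hzk']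
              refine lt_of_le_of_ne (not_lt.mp hcon) ?_
              exact z.injective.ne hkk.symm)
            tauto
          have hz2 := length_mul_adjacent_of_lt z hk hzz
          rw [← hs, hzs] at hz2
          rw [if_pos hcov, if_pos hzz, if_pos (show length w = length z + 1 by omega)]
        · rw [if_neg hcov]
          split_ifs with h1 h2 h3 <;> try rfl
          all_goals first
            | exact absurd (by
                have hz2 := length_mul_adjacent_of_lt z hk (by assumption)
                rw [← hs, hzs] at hz2
                omega) hcov
            | simp
  · rw [if_neg hw]
    have hw' : w k' < w k := lt_of_le_of_ne (not_lt.mp hw) (w.injective.ne hkk.symm)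
    have hws := length_mul_adjacent_of_gt w hk hw'
    rw [← hs] at hws
    by_cases c1 : l = k ∧ j = k'
    · have hz' : z = w * s := by
        rw [hzdef, c1.1, c1.2, hs, swap_apply_left, swap_apply_right, swap_comm]
      have : ¬ s l < s j := by
        rw [c1.1, c1.2, hs, swap_apply_left, swap_apply_right, Fin.lt_def]; omega
      rw [← hzs, hz', mul_assoc, hss, mul_one, if_pos hws, if_neg this]
      simp [hcorr, c1, hs, hw']
    · by_cases c2 : l = k' ∧ j = k
      · have hz' : z = w * s := by
          rw [hzdef, c2.1, c2.2, hs, swap_apply_left, swap_apply_right]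
        have : s l < s j := by
          rw [c2.1, c2.2, hs, swap_apply_left, swap_apply_right, Fin.lt_def]; omega
        rw [← hzs, hz', mul_assoc, hss, mul_one, if_pos hws, if_pos this]
        simp [hcorr, c2, hs, hw', hkk.symm]
      · have hc0 : corr j = 0 := by simp only [hcorr]; rw [if_neg c1, if_neg c2]
        rw [hc0, add_zero]
        by_cases hcov : length w = length z + 1
        · have hzz : ¬ z k < z k' := by
            intro hcon
            have := eq_adjacent_of_cover' hk hw' hcov hcon
            have e1 : s l = k ↔ l = k' := by rw [hs, swap_apply_eq_iff, swap_apply_left]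
            have e2 : s l = k' ↔ l = k := by rw [hs, swap_apply_eq_iff, swap_apply_right]
            have e3 : s j = k ↔ j = k' := by rw [hs, swap_apply_eq_iff, swap_apply_left]
            have e4 : s j = k' ↔ j = k := by rw [hs, swap_apply_eq_iff, swap_apply_right]
            rw [e1, e2, e3, e4] at this
            tauto
          simp [hzz]
        · rw [if_neg hcov]

/-- The value of `monkOp` at `w` only depends on values on smaller lengths. -/
theorem monkOp_congr (l : Fin n) {F G : Perm (Fin n) → R} {w : Perm (Fin n)}
    (h : ∀ u, length u + 1 = length w → F u = G u) : monkOp R l F w = monkOp R l G w := by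
  rw [monkOp_apply, monkOp_apply]
  refine sum_congr rfl fun j _ => ?_
  split_ifs with h1 h2
  · exact h _ h1.symm
  · rw [h _ h1.symm]
  · rfl

theorem swap_eq_sub_rootCoeff {k k' : Fin n} (hkk : k ≠ k') (l : Fin n) :
    monkOp R (swap k k' l) =
      monkOp R l - rootCoeff R k k' l • (monkOp R k - monkOp R k') := by
  unfold rootCoeff
  by_cases h : l = k
  · subst h; simp
  · by_cases h' : l = k'
    · subst h'; simp [hkk.symm]; module
    · simp [h, h', swap_apply_of_ne_of_ne h h']

/-- The constant terms of the twisted Leibniz rule cancel in a commutator, so a divided difference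
passes through it and merely permutes the variables. -/
theorem divDiff_mul_commutator {k k' : Fin n} (hk : (k : ℕ) + 1 = k') (i j : Fin n) :
    divDiff R k k' * (monkOp R i * monkOp R j - monkOp R j * monkOp R i) =
      (monkOp R (swap k k' i) * monkOp R (swap k k' j) -
        monkOp R (swap k k' j) * monkOp R (swap k k' i)) * divDiff R k k' := by
  have hkk : k ≠ k' := by rw [Ne, Fin.ext_iff]; omega
  have key : ∀ i j : Fin n, divDiff R k k' * (monkOp R i * monkOp R j) =
      monkOp R (swap k k' i) * monkOp R (swap k k' j) * divDiff R k k' +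
        rootCoeff R k k' j • monkOp R (swap k k' i) + rootCoeff R k k' i • monkOp R j := by
    intro i j
    rw [← mul_assoc, divDiff_mul_monkOp hk, add_mul, mul_assoc, divDiff_mul_monkOp hk, mul_add,
      ← mul_assoc, smul_mul_assoc, one_mul, mul_smul_comm, mul_one]
  rw [mul_sub, key, key, sub_mul, swap_eq_sub_rootCoeff hkk i, swap_eq_sub_rootCoeff hkk j]
  module

/-- An element killed by all divided differences is supported at the identity. -/
theorem eq_zero_of_divDiff {F : Perm (Fin n) → R}
    (h : ∀ k k' : Fin n, (k : ℕ) + 1 = k' → divDiff R k k' F = 0) {w : Perm (Fin n)}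
    (hw : w ≠ 1) : F w = 0 := by
  obtain ⟨k, k', hk, hd⟩ := exists_descent hw
  have := congrFun (h k k' hk) (w * swap k k')
  rw [divDiff_apply] at this
  simpa [hd, mul_assoc] using this

theorem divDiff_apply_eq_zero {m : ℕ} {k k' : Fin n} (hk : (k : ℕ) + 1 = k')
    {F : Perm (Fin n) → R} (hF : ∀ u, length u ≠ m → F u = 0) {w : Perm (Fin n)}
    (hw : length w + 1 ≠ m) : divDiff R k k' F w = 0 := by
  rw [divDiff_apply]
  split_ifs with h
  · apply hF
    rw [length_mul_adjacent_of_lt w hk h]; exact hw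
  · rfl

/-- A divided difference lowers the degree, so by induction every divided difference of the
commutator vanishes and it is supported at the identity. There it vanishes too, because the identity
covers nothing. -/
theorem commutator_homogeneous (m : ℕ) (i j : Fin n) (F : Perm (Fin n) → R)
    (hF : ∀ u, length u ≠ m → F u = 0) :
    (monkOp R i * monkOp R j - monkOp R j * monkOp R i) F = 0 := by
  induction m generalizing i j F with
  | zero =>
    funext w
    by_cases hw : w = 1
    · subst hw
      rw [LinearMap.sub_apply, Pi.sub_apply, Module.End.mul_apply, Module.End.mul_apply,
        monkOp_apply, monkOp_apply]
      simp [length_one]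
    · refine eq_zero_of_divDiff (fun k k' hk => ?_) hw
      rw [← Module.End.mul_apply, divDiff_mul_commutator hk, Module.End.mul_apply]
      have : divDiff R k k' F = 0 := by
        funext v; exact divDiff_apply_eq_zero hk hF (by omega)
      rw [this, map_zero]
  | succ m ih =>
    funext w
    by_cases hw : w = 1
    · subst hw
      rw [LinearMap.sub_apply, Pi.sub_apply, Module.End.mul_apply, Module.End.mul_apply,
        monkOp_apply, monkOp_apply]
      simp [length_one]
    · refine eq_zero_of_divDiff (fun k k' hk => ?_) hw
      rw [← Module.End.mul_apply, divDiff_mul_commutator hk, Module.End.mul_apply]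
      exact ih _ _ _ fun u hu => divDiff_apply_eq_zero hk hF (by omega)

theorem monkOp_comm (i j : Fin n) : monkOp R i * monkOp R j = monkOp R j * monkOp R i := by
  rw [← sub_eq_zero]
  apply LinearMap.ext
  intro F
  -- Decomposition of `F` into its homogeneous components with respect to length.
  have : F = ∑ m ∈ range ((univ.sup (length : Perm (Fin n) → ℕ)) + 1),
      fun u => if length u = m then F u else 0 := by
    funext u
    rw [Finset.sum_apply, Finset.sum_ite_eq, if_pos]
    rw [mem_range, Nat.lt_succ_iff]
    exact Finset.le_sup (f := length) (mem_univ u)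
  rw [this, map_sum, LinearMap.zero_apply]
  refine sum_eq_zero fun m _ => commutator_homogeneous m i j _ fun u hu => if_neg hu

/-- The simple reflection in the Schubert basis. -/
def reflOp (R : Type*) [CommRing R] (k k' : Fin n) : Module.End R (Perm (Fin n) → R) :=
  1 - (monkOp R k - monkOp R k') * divDiff R k k'

/-- This justifies the name of `reflOp`: it permutes the variables like a simple reflection. The
twisted Leibniz rule and commutativity give it. -/
theorem monkOp_mul_reflOp {k k' : Fin n} (hk : (k : ℕ) + 1 = k') (l : Fin n) :
    monkOp R (swap k k' l) * reflOp R k k' = reflOp R k k' * monkOp R l := by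
  have hkk : k ≠ k' := by rw [Ne, Fin.ext_iff]; omega
  have hc : monkOp R (swap k k' l) * (monkOp R k - monkOp R k') =
    (monkOp R k - monkOp R k') * monkOp R (swap k k' l) := by
    rw [mul_sub, sub_mul, monkOp_comm, monkOp_comm _ k']
  have h1 : (monkOp R k - monkOp R k') * divDiff R k k' * monkOp R l =
      monkOp R (swap k k' l) * ((monkOp R k - monkOp R k') * divDiff R k k') +
        rootCoeff R k k' l • (monkOp R k - monkOp R k') := by
    rw [mul_assoc, divDiff_mul_monkOp hk, ← mul_assoc _ _ (divDiff R k k'), hc, mul_add, mul_assoc,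
      mul_smul_comm, mul_one]
  unfold reflOp
  rw [mul_sub, sub_mul 1, h1, mul_one, one_mul]
  nth_rewrite 1 [swap_eq_sub_rootCoeff hkk l]
  abel

end Operators

/-! ### Chains -/

/-- The weighted number of saturated chains of length `l` from the identity to `w`. -/
def chainSum (w : Perm (Fin n)) (l : ℕ) : MvPolynomial (Fin n) ℚ :=
  ∑ c ∈ satChains 1 w l, ∏ i : Fin l, edgeWeight (c i.castSucc) (c i.succ)

open Classical in
theorem chainSum_succ (w : Perm (Fin n)) (l : ℕ) :
    chainSum w (l + 1) = ∑ u with Covers u w, edgeWeight u w * chainSum u l := by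
  unfold chainSum
  simp only [mul_sum]
  rw [sum_sigma']
  refine Finset.sum_bij' (fun c _ => ⟨c (Fin.last l).castSucc, fun i => c i.castSucc⟩)
    (fun p _ => Fin.snoc p.2 w) ?_ ?_ ?_ ?_ ?_
  · intro c hc
    simp only [satChains, mem_filter, mem_univ, true_and, mem_sigma] at hc ⊢
    obtain ⟨h0, h1, h2⟩ := hc
    refine ⟨?_, ?_, ?_⟩
    · have := h2 (Fin.last l)
      rwa [Fin.succ_last, h1] at this
    · simpa using h0
    · intro i
      exact h2 i.castSucc
  · rintro ⟨u, d⟩ hd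
    simp only [satChains, mem_filter, mem_univ, true_and, mem_sigma] at hd ⊢
    obtain ⟨h, h0, h1, h2⟩ := hd
    refine ⟨?_, ?_, ?_⟩
    · have := Fin.snoc_castSucc (α := fun _ => Perm (Fin n)) w d 0
      rw [Fin.castSucc_zero] at this
      rw [this, h0]
    · exact Fin.snoc_last _ _
    · intro i
      refine Fin.lastCases ?_ (fun i => ?_) i
      · rw [Fin.succ_last, Fin.snoc_last, Fin.snoc_castSucc, h1]
        exact h
      · rw [Fin.succ_castSucc, Fin.snoc_castSucc, Fin.snoc_castSucc]
        exact h2 i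
  · intro c hc
    simp only [satChains, mem_filter, mem_univ, true_and] at hc
    funext i
    refine Fin.lastCases ?_ (fun i => ?_) i
    · simp [hc.2.1]
    · simp
  · rintro ⟨u, d⟩ hd
    simp only [satChains, mem_filter, mem_univ, true_and, mem_sigma] at hd
    simp [hd.2.2.1]
  · intro c hc
    simp only [satChains, mem_filter, mem_univ, true_and] at hc
    rw [Fin.prod_univ_castSucc, mul_comm, Fin.succ_last, hc.2.1]
    rfl

theorem degPoly_eq_chainSum (w : Perm (Fin n)) :
    degPoly w = C (1 / ((length w).factorial : ℚ)) * chainSum w (length w) := by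
  have : length w - length (1 : Perm (Fin n)) = length w := by rw [length_one, Nat.sub_zero]
  unfold degPoly degPoly₂ chainSum
  rw [this]

-- A cover by `swap i j` with `i < j` has weight `X i - X j`. Collecting the coefficient of each `X
-- l` gives a plus sign when `l` is the smaller index and a minus sign when it is the larger one,
-- which is the sign rule of `monkOp`.
open Classical in
theorem sum_edgeWeight_mul (G : Perm (Fin n) → MvPolynomial (Fin n) ℚ) (w : Perm (Fin n)) :
    ∑ u with Covers u w, edgeWeight u w * G u = ∑ l, X l * monkOp _ l G w := by
  have h1 : ∀ (u : Perm (Fin n)) (p : Fin n × Fin n), (Covers u w ∧ p.1 < p.2 ∧ w = u * swap p.1 p.2) ↔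
      (u = w * swap p.1 p.2 ∧ p.1 < p.2 ∧ length w = length (w * swap p.1 p.2) + 1) := by
    rintro u ⟨i, j⟩
    constructor
    · rintro ⟨⟨_, h1⟩, h2, rfl⟩
      simpa [mul_assoc, h2] using h1
    · rintro ⟨rfl, h2, h3⟩
      refine ⟨⟨⟨i, j, h2, ?_⟩, h3⟩, h2, ?_⟩ <;> simp [mul_assoc]
  have h2 : ∑ u with Covers u w, edgeWeight u w * G u =
      ∑ p : Fin n × Fin n, if p.1 < p.2 ∧ length w = length (w * swap p.1 p.2) + 1 then
        (X p.1 - X p.2) * G (w * swap p.1 p.2) else 0 := by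
    unfold edgeWeight
    simp only [sum_mul, sum_filter]
    have : ∀ (u : Perm (Fin n)) (p : Fin n × Fin n), (if Covers u w then (if p.1 < p.2 ∧ w = u * swap p.1 p.2 then
        (X p.1 - X p.2 : MvPolynomial (Fin n) ℚ) else 0) * G u else 0) =
        if u = w * swap p.1 p.2 then
          if p.1 < p.2 ∧ length w = length (w * swap p.1 p.2) + 1 then
            (X p.1 - X p.2) * G (w * swap p.1 p.2) else 0 else 0 := by
      intro u p
      have := h1 u p
      by_cases h : u = w * swap p.1 p.2 ∧ p.1 < p.2 ∧ length w = length (w * swap p.1 p.2) + 1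
      · have h' := this.mpr h
        rw [if_pos h'.1, if_pos h'.2, if_pos h.1, if_pos h.2, h.1]
      · have h' := fun e => h (this.mp e)
        split_ifs <;> first | rfl | (exfalso; tauto)
    have h3 : ∀ p : Fin n × Fin n,
        (if p.1 < p.2 ∧ length w = length (w * swap p.1 p.2) + 1 then
          (X p.1 - X p.2 : MvPolynomial (Fin n) ℚ) * G (w * swap p.1 p.2) else 0) =
        ∑ u, if u = w * swap p.1 p.2 then
          if p.1 < p.2 ∧ length w = length (w * swap p.1 p.2) + 1 then
            (X p.1 - X p.2) * G (w * swap p.1 p.2) else 0 else 0 := by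
      intro p
      rw [Finset.sum_ite_eq', if_pos (mem_univ _)]
    rw [sum_congr rfl fun p _ => h3 p, sum_comm]
    refine sum_congr rfl fun u _ => ?_
    rw [← sum_congr rfl fun p _ => this u p]
    split_ifs
    · rfl
    · simp
  rw [h2]
  simp only [monkOp_apply, mul_sum]
  have h3 : ∀ l j : Fin n, (X l * if length w = length (w * swap l j) + 1 then
      (if l < j then G (w * swap l j) else -G (w * swap l j)) else 0 : MvPolynomial (Fin n) ℚ) =
      (if l < j ∧ length w = length (w * swap l j) + 1 then X l * G (w * swap l j) else 0) +
      (if j < l ∧ length w = length (w * swap j l) + 1 then -X l * G (w * swap j l) else 0) := by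
    intro l j
    rcases lt_trichotomy l j with h | h | h
    · simp [h, h.asymm]
    · subst h
      have : swap l l = 1 := swap_self l
      rw [this, mul_one, if_neg (by omega)]
      simp
    · simp [h, h.asymm, swap_comm j l]
  simp only [h3, sum_add_distrib]
  rw [sum_comm (s := univ) (t := univ)
    (f := fun l j => if j < l ∧ length w = length (w * swap j l) + 1 then
      -X l * G (w * swap j l) else 0), ← sum_add_distrib, Fintype.sum_prod_type]
  refine sum_congr rfl fun l _ => ?_
  rw [← sum_add_distrib]
  refine sum_congr rfl fun j _ => ?_
  split_ifs <;> ring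

/-! ### Derivatives and reflections of the dual polynomials -/

/-- The last step of a saturated chain is split off; the factor `length w` turns the factorial for
`w` into the one for the elements that `w` covers. -/
theorem degPoly_euler (w : Perm (Fin n)) :
    (length w : MvPolynomial (Fin n) ℚ) * degPoly w = ∑ l, X l * monkOp _ l degPoly w := by
  classical
  rw [← sum_edgeWeight_mul]
  rcases hl : length w with _ | m
  · rw [Nat.cast_zero, zero_mul]
    symm
    refine sum_eq_zero fun u hu => ?_
    rw [mem_filter] at hu
    have := hu.2.2
    omega
  · rw [degPoly_eq_chainSum, hl, chainSum_succ, ← mul_assoc, mul_sum]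
    refine sum_congr rfl fun u hu => ?_
    rw [mem_filter] at hu
    have hu' : length u = m := by have := hu.2.2; omega
    rw [degPoly_eq_chainSum, hu', mul_left_comm]
    congr 2
    rw [← map_natCast (C : ℚ →+* MvPolynomial (Fin n) ℚ), ← map_mul]
    congr 1
    rw [Nat.factorial_succ]
    push_cast
    field_simp

theorem degPoly_one : degPoly (1 : Perm (Fin n)) = 1 := by
  classical
  rw [degPoly_eq_chainSum, length_one]
  unfold chainSum satChains
  simp only [Nat.factorial_zero, Nat.cast_one, div_one, map_one, one_mul]
  rw [sum_eq_single (fun _ => 1)]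
  · simp
  · intro c hc hne
    exfalso
    apply hne
    rw [mem_filter] at hc
    funext i
    rw [show i = 0 from Fin.eq_zero i, hc.2.1]
  · intro h
    exfalso
    apply h
    simp

theorem eq_one_of_length_eq_zero {w : Perm (Fin n)} (h : length w = 0) : w = 1 := by
  by_contra hw
  obtain ⟨k, k', hk, hd⟩ := exists_descent hw
  have := length_mul_adjacent_of_gt w hk hd
  omega

theorem map_monkOp {R : Type*} [CommRing R] (f : R →+ R) (l : Fin n) (F : Perm (Fin n) → R)
    (w : Perm (Fin n)) : f (monkOp R l F w) = monkOp R l (fun u => f (F u)) w := by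
  rw [monkOp_apply, monkOp_apply, map_sum]
  refine sum_congr rfl fun j _ => ?_
  split_ifs <;> simp

theorem natCast_mul_left_cancel {m : ℕ} (hm : m ≠ 0) {p q : MvPolynomial (Fin n) ℚ}
    (h : (m : MvPolynomial (Fin n) ℚ) * p = m * q) : p = q :=
  mul_left_cancel₀ (Nat.cast_ne_zero.mpr hm) h

/-- Monk's rule for the dual polynomials. -/
theorem pderiv_degPoly (k : Fin n) (w : Perm (Fin n)) :
    pderiv k (degPoly w) = monkOp _ k degPoly w := by
  induction hm : length w generalizing k w with
  | zero =>
    rw [eq_one_of_length_eq_zero hm, degPoly_one, monkOp_apply]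
    simp [length_one]
  | succ m ih =>
    apply natCast_mul_left_cancel (m := length w) (by omega)
    have h1 : (length w : MvPolynomial (Fin n) ℚ) * pderiv k (degPoly w) =
        pderiv k ((length w : MvPolynomial (Fin n) ℚ) * degPoly w) := by
      simp
    rw [h1, degPoly_euler, map_sum]
    -- The induction hypothesis applies to the elements covered by `w`; commutativity then moves
    -- `monkOp k` to the outside.
    have h2 : ∀ l, pderiv k (X l * monkOp _ l degPoly w) =
        X l * (monkOp _ k (monkOp _ l degPoly)) w +
          if l = k then monkOp _ k degPoly w else 0 := by
      intro l
      rw [Derivation.leibniz, MvPolynomial.pderiv_X, smul_eq_mul, smul_eq_mul]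
      have e1 : pderiv k (monkOp _ l degPoly w) = monkOp _ k (monkOp _ l degPoly) w := by
        rw [← Module.End.mul_apply, monkOp_comm, Module.End.mul_apply]
        exact (map_monkOp (pderiv k).toLinearMap.toAddMonoidHom l degPoly w).trans
          (monkOp_congr l fun u hu => ih k u (by omega))
      rw [e1]
      by_cases h : l = k
      · subst h; simp
      · simp [h]
    rw [sum_congr rfl fun l _ => h2 l, sum_add_distrib, Finset.sum_ite_eq' univ k,
      if_pos (mem_univ _)]
    -- The Euler identity is used again, one degree lower. It contributes the factor `m`, and the
    -- Leibniz term raises this to `m + 1 = length w`.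
    have h3 : ∑ l, X l * (monkOp _ k (monkOp _ l degPoly)) w =
        monkOp _ k (fun u => (m : MvPolynomial (Fin n) ℚ) * degPoly u) w := by
      have : ∑ l, X l * (monkOp _ k (monkOp _ l degPoly)) w =
          monkOp _ k (∑ l, (X l : MvPolynomial (Fin n) ℚ) • monkOp _ l degPoly) w := by
        rw [map_sum, Finset.sum_apply]
        refine sum_congr rfl fun l _ => ?_
        rw [map_smul, Pi.smul_apply, smul_eq_mul]
      rw [this]
      refine monkOp_congr k fun u hu => ?_
      rw [Finset.sum_apply]
      simp only [Pi.smul_apply, smul_eq_mul]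
      rw [← degPoly_euler, show length u = m by omega]
    have h4 : monkOp _ k (fun u => (m : MvPolynomial (Fin n) ℚ) * degPoly u) w =
        m * monkOp _ k degPoly w := by
      have := congrFun ((monkOp _ k).map_smul (m : MvPolynomial (Fin n) ℚ) degPoly) w
      exact this
    rw [h3, h4, hm]
    push_cast
    ring

/-- `reflOp` preserves degree: the divided difference lowers it by one and `monkOp` raises it again.
-/
theorem reflOp_congr_length {R : Type*} [CommRing R] (k k' : Fin n) (hk : (k : ℕ) + 1 = k')
    {F G : Perm (Fin n) → R} {w : Perm (Fin n)} (h : ∀ u, length u = length w → F u = G u) :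
    reflOp R k k' F w = reflOp R k k' G w := by
  have : ∀ l, monkOp R l (divDiff R k k' F) w = monkOp R l (divDiff R k k' G) w := by
    intro l
    refine monkOp_congr l fun u hu => ?_
    rw [divDiff_apply, divDiff_apply]
    split_ifs with hlt
    · refine h _ ?_
      rw [length_mul_adjacent_of_lt u hk hlt, hu]
    · rfl
  simp only [reflOp, LinearMap.sub_apply, Module.End.one_apply, Module.End.mul_apply, Pi.sub_apply]
  rw [this, this, h w rfl]

/-- Permuting the variables in the Euler identity reduces the claim to smaller length, because
`reflOp` intertwines the operators `monkOp` in the same way. -/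
theorem rename_swap_degPoly {k k' : Fin n} (hk : (k : ℕ) + 1 = k') (w : Perm (Fin n)) :
    rename (swap k k') (degPoly w) = reflOp _ k k' degPoly w := by
  induction hm : length w generalizing w with
  | zero =>
    rw [eq_one_of_length_eq_zero hm, degPoly_one, map_one]
    simp only [reflOp, LinearMap.sub_apply, Module.End.one_apply, Module.End.mul_apply,
      Pi.sub_apply]
    rw [monkOp_apply, monkOp_apply]
    simp [length_one, degPoly_one]
  | succ m ih =>
    apply natCast_mul_left_cancel (m := length w) (by omega)
    have h1 : (length w : MvPolynomial (Fin n) ℚ) * rename (swap k k') (degPoly w) =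
        rename (swap k k') ((length w : MvPolynomial (Fin n) ℚ) * degPoly w) := by
      simp
    rw [h1, degPoly_euler, map_sum, ← Equiv.sum_comp (swap k k')]
    have h2 : ∀ l, rename (swap k k') (X (swap k k' l) *
        monkOp (MvPolynomial (Fin n) ℚ) (swap k k' l) degPoly w) =
        reflOp _ k k' ((X l : MvPolynomial (Fin n) ℚ) • monkOp _ l degPoly) w := by
      intro l
      rw [map_mul, MvPolynomial.rename_X, swap_apply_self, map_smul, ← Module.End.mul_apply,
        ← monkOp_mul_reflOp hk, Pi.smul_apply, smul_eq_mul, Module.End.mul_apply]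
      congr 1
      exact (map_monkOp (rename (swap k k')).toLinearMap.toAddMonoidHom _ degPoly w).trans
        (monkOp_congr _ fun u hu => ih u (by omega))
    rw [sum_congr rfl fun l _ => h2 l, ← Finset.sum_apply, ← map_sum]
    have h3 : reflOp (MvPolynomial (Fin n) ℚ) k k'
        (∑ l, (X l : MvPolynomial (Fin n) ℚ) • monkOp _ l degPoly) w =
        reflOp _ k k' ((length w : MvPolynomial (Fin n) ℚ) • degPoly) w := by
      refine reflOp_congr_length k k' hk fun u hu => ?_
      rw [Finset.sum_apply]
      simp only [Pi.smul_apply, smul_eq_mul]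
      rw [← degPoly_euler, hu]
    rw [h3, map_smul]
    rfl

/-- Every divided difference at `k` takes the value 0 at a permutation with a descent at `k`. The
twisted Leibniz rule, evaluated at `w`, therefore shows that the subtracted part of `reflOp` equals
twice `degPoly w`. -/
theorem rename_swap_degPoly_of_descent {k k' : Fin n} (hk : (k : ℕ) + 1 = k') {w : Perm (Fin n)}
    (hw : w k' < w k) : rename (swap k k') (degPoly w) = -degPoly w := by
  have hkk : k' ≠ k := by rw [Ne, Fin.ext_iff]; omega
  have key : ∀ l, monkOp (MvPolynomial (Fin n) ℚ) (swap k k' l) (divDiff _ k k' degPoly) w =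
      -(rootCoeff _ k k' l * degPoly w) := by
    intro l
    have := congrFun (LinearMap.congr_fun (divDiff_mul_monkOp (R := MvPolynomial (Fin n) ℚ) hk l)
      degPoly) w
    rw [Module.End.mul_apply, divDiff_apply, if_neg hw.asymm] at this
    simp only [LinearMap.add_apply, Module.End.mul_apply, LinearMap.smul_apply, Pi.add_apply,
      Module.End.one_apply, Pi.smul_apply, smul_eq_mul] at this
    exact eq_neg_of_add_eq_zero_left this.symm
  have k1 := key k'
  have k2 := key k
  rw [swap_apply_right] at k1
  rw [swap_apply_left] at k2
  rw [rename_swap_degPoly hk]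
  simp only [reflOp, LinearMap.sub_apply, Module.End.one_apply, Module.End.mul_apply,
    Pi.sub_apply]
  rw [k1, k2]
  simp only [rootCoeff, if_neg hkk, if_true]
  ring

/-! ### Last descents and the transition formula -/

/-- The position `r` is the last descent of `v`, and `s` is the last position with a value
smaller than `v r`. -/
structure IsLastDescent (v : Perm (Fin n)) (r s : Fin n) : Prop where
  lt : r < s
  val_lt : v s < v r
  lt_of_gt : ∀ j, s < j → v r < v j
  incr : ∀ a b, r < a → a < b → v a < v b

/-- The transitions `v ↦ v s_{rs} s_{qr}`. -/
def IsTransition (v : Perm (Fin n)) (r s q : Fin n) : Prop :=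
  q < r ∧ v q < v s ∧ ∀ k, q < k → k < r → ¬ (v q < v k ∧ v k < v s)

theorem mem_invSet {v : Perm (Fin n)} {i j : Fin n} : j ∈ invSet v i ↔ i < j ∧ v j < v i := by
  simp [invSet]

theorem exists_isLastDescent {v : Perm (Fin n)} (hv : v ≠ 1) : ∃ r s, IsLastDescent v r s := by
  obtain ⟨k, k', hk, hd⟩ := exists_descent hv
  have h1 : ({i | (invSet v i).Nonempty} : Finset (Fin n)).Nonempty :=
    ⟨k, by simpa using ⟨k', mem_invSet.mpr ⟨by rw [Fin.lt_def]; omega, hd⟩⟩⟩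
  set r := ({i | (invSet v i).Nonempty} : Finset (Fin n)).max' h1 with hr
  have hr1 : (invSet v r).Nonempty := by
    have := max'_mem _ h1
    rw [← hr, mem_filter] at this
    exact this.2
  set s := (invSet v r).max' hr1 with hs
  have hs1 := mem_invSet.mp (max'_mem _ hr1)
  rw [← hs] at hs1
  refine ⟨r, s, hs1.1, hs1.2, ?_, ?_⟩
  · intro j hj
    by_contra hcon
    have hne : v j ≠ v r := v.injective.ne (by omega)
    have : j ∈ invSet v r := mem_invSet.mpr ⟨by omega, by omega⟩
    have := le_max' _ _ this
    omega
  · intro a b ha hab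
    by_contra hcon
    have hne : v a ≠ v b := v.injective.ne (by omega)
    have : b ∈ invSet v a := mem_invSet.mpr ⟨hab, by omega⟩
    have := le_max' ({i | (invSet v i).Nonempty} : Finset (Fin n)) a (by simpa using ⟨b, this⟩)
    omega

namespace IsLastDescent
variable {v : Perm (Fin n)} {r s : Fin n}

theorem swap_apply (h : IsLastDescent v r s) (x : Fin n) :
    (x = r ∧ (v * swap r s) x = v s) ∨ (x = s ∧ (v * swap r s) x = v r) ∨
      (x ≠ r ∧ x ≠ s ∧ (v * swap r s) x = v x) := by
  have := h.lt.ne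
  rw [Perm.mul_apply, swap_apply_def]
  split_ifs <;> tauto

theorem swap_incr (h : IsLastDescent v r s) {a b : Fin n} (ha : r < a) (hab : a < b) :
    (v * swap r s) a < (v * swap r s) b := by
  have h1 := h.incr a b ha hab
  have h2 := h.lt_of_gt b
  have h3 := h.val_lt
  rcases h.swap_apply a with ⟨e, ea⟩ | ⟨e, ea⟩ | ⟨e, e', ea⟩ <;>
  rcases h.swap_apply b with ⟨f, eb⟩ | ⟨f, eb⟩ | ⟨f, f', eb⟩ <;> rw [ea, eb]
  all_goals first | omega | (subst f; omega)

theorem length_swap (h : IsLastDescent v r s) : length v = length (v * swap r s) + 1 := by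
  rw [length_mul_swap_iff _ h.lt]
  refine ⟨h.val_lt, fun k h1 h2 => ?_⟩
  have := h.incr k s h1 h2
  omega

theorem invSet_swap_of_lt (h : IsLastDescent v r s) {p : Fin n} (hp : p < r) :
    invSet (v * swap r s) p = (invSet v p).map (swap r s).toEmbedding := by
  ext j
  have hr := h.lt
  rw [mem_map_equiv, symm_swap, mem_invSet, mem_invSet, Perm.mul_apply, Perm.mul_apply,
    swap_apply_of_ne_of_ne hp.ne (by omega)]
  refine and_congr_left fun _ => ?_
  rw [swap_apply_def]
  split_ifs <;> omega

theorem invSet_eq_empty (h : IsLastDescent v r s) {p : Fin n} (hp : r < p) : invSet v p = ∅ := by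
  ext j
  have := h.incr p j hp
  simp only [mem_invSet, notMem_empty, iff_false]
  omega

theorem invSet_swap_eq_empty (h : IsLastDescent v r s) {p : Fin n} (hp : r < p) :
    invSet (v * swap r s) p = ∅ := by
  ext j
  have := @swap_incr _ _ _ _ h p j hp
  simp only [mem_invSet, notMem_empty, iff_false]
  omega

theorem mem_invSet_self (h : IsLastDescent v r s) : s ∈ invSet v r :=
  mem_invSet.mpr ⟨h.lt, h.val_lt⟩

theorem invSet_swap_self (h : IsLastDescent v r s) :
    invSet (v * swap r s) r = (invSet v r).erase s := by
  ext j
  rw [mem_erase, mem_invSet, mem_invSet]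
  have h1 := h.lt
  have h2 := h.val_lt
  have h3 := h.lt_of_gt j
  have h4 := h.incr j s
  rw [Perm.mul_apply _ _ r, swap_apply_left]
  rcases h.swap_apply j with ⟨e, ea⟩ | ⟨e, ea⟩ | ⟨e, e', ea⟩ <;> rw [ea]
  · omega
  · subst e; omega
  · omega

theorem code_swap_of_ne (h : IsLastDescent v r s) {p : Fin n} (hp : p ≠ r) :
    code (v * swap r s) p = code v p := by
  unfold code
  rcases lt_or_gt_of_ne hp with hp | hp
  · rw [h.invSet_swap_of_lt hp, card_map]
  · rw [h.invSet_swap_eq_empty hp, h.invSet_eq_empty hp]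

theorem code_self (h : IsLastDescent v r s) : code v r = code (v * swap r s) r + 1 := by
  unfold code
  rw [h.invSet_swap_self, card_erase_add_one h.mem_invSet_self]

end IsLastDescent

/-- The polynomials `𝔇` indexed by `w_∘ v`. -/
def codegPoly (v : Perm (Fin n)) : MvPolynomial (Fin n) ℚ := degPoly (longest n * v)

theorem longest_lt {v : Perm (Fin n)} {i j : Fin n} :
    (longest n * v) i < (longest n * v) j ↔ v j < v i := by
  simp [longest]

theorem length_longest_mul_iff (u : Perm (Fin n)) {i j : Fin n} (hij : i < j) :
    length (longest n * u) = length (longest n * u * swap i j) + 1 ↔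
      u i < u j ∧ ∀ k, i < k → k < j → ¬ (u i < u k ∧ u k < u j) := by
  rw [length_mul_swap_iff _ hij]
  simp only [longest_lt]
  refine and_congr_right fun _ => forall_congr' fun k => ?_
  rw [and_comm (a := u k < u j)]

-- This is the derivative rule for `∂/∂y_r` at `u = v * swap r s`, solved for `codegPoly v`.
-- Multiplication by the longest element turns lower covers into upper covers. To the right of `r`
-- only the exchange with `s` gives a cover, by the choice of `r` and `s`; those to the left are the
-- transitions and enter with a minus sign.
open Classical in
theorem codegPoly_transition {v : Perm (Fin n)} {r s : Fin n} (h : IsLastDescent v r s) :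
    codegPoly v = pderiv r (codegPoly (v * swap r s)) +
      ∑ q with IsTransition v r s q, codegPoly (v * swap r s * swap q r) := by
  unfold codegPoly
  rw [pderiv_degPoly, monkOp_apply, sum_filter, ← sum_add_distrib]
  set u := v * swap r s with hu
  have hur : u r = v s := by simp [hu]
  have hus : u s = v r := by simp [hu]
  have huk : ∀ k, k ≠ r → k ≠ s → u k = v k := fun k h1 h2 => by
    rw [hu, Perm.mul_apply, swap_apply_of_ne_of_ne h1 h2]
  have hrs := h.lt
  have hv := h.val_lt
  rw [sum_eq_single s]
  · rw [if_pos, if_pos h.lt, if_neg, add_zero, mul_assoc, hu, mul_assoc v, swap_mul_self, mul_one]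
    · intro hq; have := hq.1; omega
    · rw [length_longest_mul_iff _ h.lt]
      refine ⟨by omega, fun k h1 h2 => ?_⟩
      rw [huk k (by omega) (by omega)]
      have := h.incr k s h1 h2
      omega
  · intro j _ hj
    rcases lt_trichotomy j r with hjr | hjr | hjr
    · have hiff : length (longest n * u) = length (longest n * u * swap r j) + 1 ↔
          IsTransition v r s j := by
        rw [swap_comm, length_longest_mul_iff _ hjr, IsTransition, huk j (by omega) (by omega), hur]
        simp only [hjr, true_and]
        refine and_congr_right fun _ => forall_congr' fun k => forall_congr' fun _ =>
          forall_congr' fun hk => ?_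
        rw [huk k (by omega) (by omega)]
      simp only [hiff, if_neg hjr.asymm]
      split_ifs
      · rw [swap_comm, mul_assoc]; exact neg_add_cancel _
      · simp
    · subst hjr
      rw [if_neg, if_neg, zero_add]
      · intro hq; have := hq.1; omega
      · have : swap j j = 1 := swap_self j
        rw [this, mul_one]; omega
    · rw [if_neg, if_neg, zero_add]
      · intro hq; have := hq.1; omega
      · rw [length_longest_mul_iff _ hjr, huk j (by omega) (by omega), hur]
        rintro ⟨h1, h2⟩
        have h3 := h.incr j s hjr
        have h4 := h2 s h.lt
        have h5 := h.lt_of_gt j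
        rw [hus] at h4
        omega
  · simp

/-! ### Vexillary permutations -/

/-- The inequalities that say that `v` avoids `2143`. -/
def Vex (v : Perm (Fin n)) : Prop :=
  ∀ a b c d, a < b → b < c → c < d → ¬ (v b < v a ∧ v a < v d ∧ v d < v c)

/-- The values after `r` still increase, so the third position of a forbidden pattern is at most
`r`. The first two values are then unchanged, and suitable last two positions give the pattern
already in `v`. -/
theorem Vex.swap {v : Perm (Fin n)} {r s : Fin n} (hv : Vex v) (h : IsLastDescent v r s) :
    Vex (v * Equiv.swap r s) := by
  rintro a b c d hab hbc hcd ⟨h1, h2, h3⟩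
  have hrs := h.lt
  have hv' := h.val_lt
  have hcr : c ≤ r := by
    by_contra hcon
    have := h.swap_incr (not_le.mp hcon) hcd
    omega
  have va : (v * Equiv.swap r s) a = v a := by
    rcases h.swap_apply a with e | e | e <;> omega
  have vb : (v * Equiv.swap r s) b = v b := by
    rcases h.swap_apply b with e | e | e <;> omega
  rw [va] at h1 h2
  rw [vb] at h1
  rcases h.swap_apply d with ⟨e, ea⟩ | ⟨e, ea⟩ | ⟨e, e', ea⟩ <;>
  rcases h.swap_apply c with ⟨f, eb⟩ | ⟨f, eb⟩ | ⟨f, f', eb⟩ <;> rw [ea] at h2 <;> rw [ea, eb] at h3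
  all_goals
    have i1 := hv a b c s
    have i2 := hv a b c r
    have i3 := hv a b c d
    have i4 := hv a b r d
    omega

theorem IsTransition.apply {v : Perm (Fin n)} {r s q : Fin n} (hq : IsTransition v r s q)
    (h : IsLastDescent v r s) (x : Fin n) :
    (x = r ∧ (v * Equiv.swap r s * swap q r) x = v q) ∨
    (x = s ∧ (v * Equiv.swap r s * swap q r) x = v r) ∨
    (x = q ∧ (v * Equiv.swap r s * swap q r) x = v s) ∨
      (x ≠ r ∧ x ≠ s ∧ x ≠ q ∧ (v * Equiv.swap r s * swap q r) x = v x) := by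
  have h1 := hq.1
  have h2 := h.lt
  rw [Perm.mul_apply, Perm.mul_apply]
  by_cases e1 : x = q
  · subst e1
    right; right; left; simp
  · by_cases e2 : x = r
    · subst e2
      left
      rw [swap_apply_right, swap_apply_of_ne_of_ne h1.ne (by omega)]; simp
    · rw [swap_apply_of_ne_of_ne e1 e2, swap_apply_def]
      split_ifs <;> tauto

theorem IsTransition.incr {v : Perm (Fin n)} {r s q : Fin n} (hq : IsTransition v r s q)
    (h : IsLastDescent v r s) {a b : Fin n} (ha : r < a) (hab : a < b) :
    (v * Equiv.swap r s * swap q r) a < (v * Equiv.swap r s * swap q r) b := by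
  have h1 := hq.1
  have h2 := h.lt
  rw [Perm.mul_apply, Perm.mul_apply _ (swap q r), swap_apply_of_ne_of_ne (by omega) (by omega),
    swap_apply_of_ne_of_ne (by omega) (by omega)]
  exact h.swap_incr ha hab

/-- If `q < q'` were two transitions, the positions `q, q', r, s` would carry the pattern 2143. -/
theorem IsTransition.unique {v : Perm (Fin n)} {r s q q' : Fin n} (hv : Vex v)
    (h : IsLastDescent v r s) (hq : IsTransition v r s q) (hq' : IsTransition v r s q') :
    q = q' := by
  wlog hlt : q < q' generalizing q q'
  · by_contra hne
    exact hne (this hq' hq (by omega)).symm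
  exfalso
  have h1 := hq.2.2 q' hlt hq'.1
  have h2 := hv q q' r s hlt hq'.1 h.lt
  have h3 := hq.1
  have h4 := hq'.2.1
  have h5 := hq.2.1
  have h6 := h.val_lt
  have : v q ≠ v q' := v.injective.ne hlt.ne
  omega

theorem Vex.transition {v : Perm (Fin n)} {r s q : Fin n} (hv : Vex v) (h : IsLastDescent v r s)
    (hq : IsTransition v r s q) : Vex (v * Equiv.swap r s * Equiv.swap q r) := by
  rintro a b c d hab hbc hcd ⟨h1, h2, h3⟩
  have hrs := h.lt
  have hv' := h.val_lt
  obtain ⟨hqr, hqs, hk⟩ := hq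
  have hq : IsTransition v r s q := ⟨hqr, hqs, hk⟩
  have hcr : c ≤ r := by
    by_contra hcon
    have := hq.incr h (not_le.mp hcon) hcd
    omega
  have ea := hq.apply h a
  have eb := hq.apply h b
  have ec := hq.apply h c
  have ed := hq.apply h d
  set t := v * Equiv.swap r s * Equiv.swap q r
  replace ea : (a = q ∧ t a = v s) ∨ (a ≠ q ∧ t a = v a) := by
    rcases ea with e | e | e | e
    · omega
    · omega
    · exact Or.inl e
    · exact Or.inr e.2.2
  replace eb : (b = q ∧ t b = v s) ∨ (b ≠ q ∧ t b = v b) := by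
    rcases eb with e | e | e | e
    · omega
    · omega
    · exact Or.inl e
    · exact Or.inr e.2.2
  rcases ec with ⟨g, ec⟩ | ⟨g, ec⟩ | ⟨g, ec⟩ | ⟨g, g', g'', ec⟩
  · have i2 := hv a b r d
    subst g
    rcases ed with ⟨k, ed⟩ | ⟨k, ed⟩ | ⟨k, ed⟩ | ⟨k, k', k'', ed⟩
    · omega
    · omega
    · omega
    · rcases ea with ⟨e, ea⟩ | ⟨e, ea⟩
      · omega
      · rcases eb with ⟨f, eb⟩ | ⟨f, eb⟩ <;> omega
  · omega
  · replace ea : t a = v a := by omega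
    replace eb : t b = v b := by omega
    subst g
    rw [ec] at h3
    rw [ea] at h1 h2
    rw [eb] at h1
    rcases ed with ⟨k, ed⟩ | ⟨k, ed⟩ | ⟨k, ed⟩ | ⟨k, k', k'', ed⟩ <;> rw [ed] at h2 h3
    · have i4 := hv a b r s
      omega
    · omega
    · omega
    · have i2 := hv a b r d
      have i3 := hv a b c d
      have nd := hk d hcd
      have ne3 : v d ≠ v c := v.injective.ne k''
      omega
  · rw [ec] at h3
    have hcr' : c < r := by omega
    -- In the remaining case `c` has its old value, and `d'` replaces `d` as last position of the
    -- pattern in `v`. If `d = r`, the value comes from `q`; when `q` is not to the right of `c`,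
    -- the position `s` serves instead, since no value between `q` and `r` lies between `v q` and `v
    -- s`.
    have main : ∃ d', (t a < v d' ∧ v d' < v c ∧ c < d') := by
      rcases ed with ⟨k, ed⟩ | ⟨k, ed⟩ | ⟨k, ed⟩ | ⟨k, k', k'', ed⟩ <;> rw [ed] at h2 h3
      · by_cases hcq : c < q
        · exact ⟨q, h2, h3, hcq⟩
        · have nc := hk c (by omega) hcr'
          have ne : v c ≠ v s := v.injective.ne (by omega)
          exact ⟨s, by omega, by omega, by omega⟩
      · exact ⟨r, h2, h3, by omega⟩
      · exact ⟨s, h2, h3, by omega⟩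
      · exact ⟨d, h2, h3, by omega⟩
    obtain ⟨d', m1, m2, m3⟩ := main
    have i := hv a b c d' hab hbc m3
    rcases ea with ⟨e, ea⟩ | ⟨e, ea⟩ <;> rcases eb with ⟨f, eb⟩ | ⟨f, eb⟩ <;>
      rw [ea, eb] at h1 <;> rw [ea] at m1
    · omega
    · subst e
      have nb := hk b hab (by omega)
      have ne : v b ≠ v a := v.injective.ne f
      omega
    · subst f
      omega
    · omega

/-! ### Differential operators -/

theorem pderiv_comm (i j : Fin n) (p : MvPolynomial (Fin n) ℚ) :
    pderiv i (pderiv j p) = pderiv j (pderiv i p) := by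
  ext m
  simp only [MvPolynomial.coeff_pderiv, add_right_comm m]
  by_cases h : i = j
  · subst h; rfl
  · simp [h, Ne.symm h]
    ring

theorem prod_ofFn_pow_add_single {E : Type*} [Monoid E] : ∀ {k : ℕ} (c : Fin k → E)
    (_ : ∀ i j, Commute (c i) (c j)) (m : Fin k → ℕ) (r : Fin k),
    (List.ofFn fun i => c i ^ ((m + Pi.single r 1 : Fin k → ℕ) i)).prod =
      c r * (List.ofFn fun i => c i ^ m i).prod
  | 0, _, _, _, r => r.elim0
  | k + 1, c, hc, m, r => by
    rw [List.ofFn_succ, List.ofFn_succ, List.prod_cons, List.prod_cons]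
    refine Fin.cases ?_ (fun r => ?_) r
    · have : ∀ i : Fin k, (m + Pi.single 0 1 : Fin (k + 1) → ℕ) i.succ = m i.succ := by
        intro i; simp
      simp only [this]
      rw [Pi.add_apply, Pi.single_eq_same, pow_succ', mul_assoc]
    · have h1 : (m + Pi.single r.succ 1 : Fin (k + 1) → ℕ) 0 = m 0 := by simp
      have h2 : ∀ i : Fin k, (m + Pi.single r.succ 1 : Fin (k + 1) → ℕ) i.succ =
          ((fun i => m i.succ) + Pi.single r 1 : Fin k → ℕ) i := by
        intro i; simp [Pi.single_apply]
      simp only [h1, h2]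
      rw [prod_ofFn_pow_add_single (fun i => c i.succ) (fun i j => hc _ _) (fun i => m i.succ) r,
        ← mul_assoc, ← mul_assoc, ((hc r.succ 0).pow_right (m 0)).eq]

theorem partialMonomial_zero : partialMonomial (0 : Fin n → ℕ) = 1 := by
  unfold partialMonomial
  refine List.prod_eq_one fun x hx => ?_
  rw [List.mem_ofFn] at hx
  obtain ⟨i, rfl⟩ := hx
  simp

theorem partialMonomial_add_single (m : Fin n → ℕ) (r : Fin n) (p : MvPolynomial (Fin n) ℚ) :
    partialMonomial (m + Pi.single r 1) p = pderiv r (partialMonomial m p) := by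
  unfold partialMonomial
  rw [prod_ofFn_pow_add_single (fun k : Fin n =>
    ((pderiv k).toLinearMap : Module.End ℚ (MvPolynomial (Fin n) ℚ)))]
  · rfl
  · intro i j
    exact LinearMap.ext fun p => pderiv_comm i j p

theorem pi_nat_induction {P : (Fin n → ℕ) → Prop} (h0 : P 0)
    (h1 : ∀ m r, P m → P (m + Pi.single r 1)) (m : Fin n → ℕ) : P m := by
  induction hs : ∑ i, m i generalizing m with
  | zero =>
    have : m = 0 := by
      funext i
      exact (Finset.sum_eq_zero_iff.mp hs) i (mem_univ i)
    rwa [this]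
  | succ k ih =>
    have : ∃ r, m r ≠ 0 := by
      by_contra! hcon
      simp [hcon] at hs
    obtain ⟨r, hr⟩ := this
    have hm : m = (m - Pi.single r 1) + Pi.single r 1 := by
      funext i
      by_cases h : i = r
      · subst h; simp; omega
      · simp [h]
    rw [hm]
    refine h1 _ r (ih _ ?_)
    rw [hm] at hs
    simp only [Pi.add_apply, sum_add_distrib] at hs
    rw [Finset.sum_pi_single'] at hs
    simpa using hs

/-- In characteristic 0 the constant coefficient of the derivative is a nonzero multiple of the
coefficient in question. The induction needs all coefficients, hence the index `d` in `key`. -/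
theorem coeff_eq_zero_of_partialMonomial (m : Fin n → ℕ) (p : MvPolynomial (Fin n) ℚ)
    (h : partialMonomial m p = 0) : coeff (Finsupp.equivFunOnFinite.symm m) p = 0 := by
  have key : ∀ m : Fin n → ℕ, ∀ d, ∃ c : ℚ, c ≠ 0 ∧ coeff d (partialMonomial m p) =
      c * coeff (d + Finsupp.equivFunOnFinite.symm m) p := by
    intro m
    induction m using pi_nat_induction with
    | h0 =>
      intro d
      refine ⟨1, one_ne_zero, ?_⟩
      rw [partialMonomial_zero, one_mul]
      congr 1
      ext i; simp
    | h1 m r ih =>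
      intro d
      obtain ⟨c, hc, h⟩ := ih (d + Finsupp.single r 1)
      refine ⟨c * (d r + 1), mul_ne_zero hc (by positivity), ?_⟩
      rw [partialMonomial_add_single, MvPolynomial.coeff_pderiv, h, mul_right_comm]
      congr 2
      ext i
      simp [Finsupp.single_apply, Pi.single_apply, eq_comm]
      ring
  obtain ⟨c, hc, h'⟩ := key m 0
  rw [h, MvPolynomial.coeff_zero, zero_add] at h'
  exact (mul_eq_zero.mp h'.symm).resolve_left hc

/-! ### Determinants of divided powers -/

/-- The convention that divided powers with negative exponent are 0 makes this uniform in `b`,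
including the derivative of the constant at `b = 0`. -/
theorem pderiv_divPow_self (i : Fin n) (b : ℤ) :
    pderiv i (divPow (X i) b) = divPow (X i) (b - 1) := by
  unfold divPow
  rcases b with b | b
  · rcases b with _ | b
    · simp
    · have e : (Int.ofNat (b + 1) - 1 : ℤ) = (b : ℤ) := by simp
      rw [e, if_pos (Int.natCast_nonneg b), if_pos (by simp; omega), MvPolynomial.pderiv_C_mul,
        MvPolynomial.pderiv_pow, MvPolynomial.pderiv_X_self]
      have e1 : (Int.ofNat (b + 1)).toNat = b + 1 := rfl
      rw [e1, Int.toNat_natCast, mul_one, Nat.add_sub_cancel, ← mul_assoc]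
      congr 1
      rw [← map_natCast (C : ℚ →+* MvPolynomial (Fin n) ℚ), ← map_mul, Nat.factorial_succ]
      congr 1
      push_cast
      field_simp
  · rw [if_neg (by simp), if_neg (by omega), map_zero]

theorem pderiv_divPow_of_ne {i j : Fin n} (h : j ≠ i) (b : ℤ) :
    pderiv i (divPow (X j) b) = 0 := by
  unfold divPow
  split_ifs
  · rw [MvPolynomial.pderiv_C_mul, MvPolynomial.pderiv_pow, MvPolynomial.pderiv_X_of_ne h]
    simp
  · simp

theorem pderiv_prod_eq_zero {i : Fin n} (s : Finset (Fin n)) (f : Fin n → MvPolynomial (Fin n) ℚ)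
    (h : ∀ j ∈ s, pderiv i (f j) = 0) : pderiv i (∏ j ∈ s, f j) = 0 := by
  classical
  induction s using Finset.induction_on with
  | empty => simp
  | insert a s ha ih =>
    rw [prod_insert ha, MvPolynomial.pderiv_mul, h a (mem_insert_self _ _),
      ih fun j hj => h j (mem_insert_of_mem hj)]
    simp

/-- Row `i` involves only the variable `X i`, so the derivative acts on row `r` alone. -/
theorem pderiv_det_divPow (a : Fin n → Fin n → ℤ) (r : Fin n) :
    pderiv r (Matrix.det (Matrix.of fun i j => divPow (X i) (a i j))) =
      Matrix.det (Matrix.of fun i j => divPow (X i) (a i j - (Pi.single r 1 : Fin n → ℤ) i)) := by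
  rw [← Matrix.det_transpose, Matrix.det_apply, ← Matrix.det_transpose, Matrix.det_apply, map_sum]
  refine sum_congr rfl fun σ _ => ?_
  rw [Units.smul_def, Units.smul_def, map_zsmul]
  congr 1
  simp only [Matrix.transpose_apply, Matrix.of_apply]
  rw [← mul_prod_erase univ _ (mem_univ r), ← mul_prod_erase univ _ (mem_univ r),
    MvPolynomial.pderiv_mul, pderiv_prod_eq_zero, pderiv_divPow_self, mul_zero, add_zero,
    Pi.single_eq_same]
  · congr 1
    refine prod_congr rfl fun j hj => ?_
    rw [Pi.single_eq_of_ne (mem_erase.mp hj).1, sub_zero]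
  · intro j hj
    exact pderiv_divPow_of_ne (mem_erase.mp hj).1 _

theorem partialMonomial_det_divPow (a : Fin n → Fin n → ℤ) (c : Fin n → ℕ) :
    partialMonomial c (Matrix.det (Matrix.of fun i j => divPow (X i) (a i j))) =
      Matrix.det (Matrix.of fun i j => divPow (X i) (a i j - c i)) := by
  induction c using pi_nat_induction with
  | h0 => rw [partialMonomial_zero]; simp
  | h1 m r ih =>
    rw [partialMonomial_add_single, ih, pderiv_det_divPow]
    congr 2
    ext1 i; ext1 j
    congr 1
    rw [Pi.add_apply, Nat.cast_add, ← sub_sub]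
    congr 1
    by_cases h : i = r
    · subst h; simp
    · simp [h]

/-- The determinant of the divided powers of the Vandermonde matrix. -/
def divVandermonde (n : ℕ) : MvPolynomial (Fin n) ℚ :=
  Matrix.det (Matrix.of fun i j : Fin n => divPow (X i) ((n : ℤ) - ((j : ℕ) + 1 : ℤ)))

theorem divVandermonde_eq (n : ℕ) :
    divVandermonde n = C (1 / factProd n) * vandermondeProd n := by
  have h1 : vandermondeProd n =
      (Matrix.projVandermonde (1 : Fin n → MvPolynomial (Fin n) ℚ) X).det := by
    rw [Matrix.det_projVandermonde]
    simp [vandermondeProd]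
  have h2 : (C (1 / factProd n) : MvPolynomial (Fin n) ℚ) =
      ∏ j : Fin n, C (1 / ((j.rev : ℕ).factorial : ℚ)) := by
    rw [← map_prod]
    congr 1
    unfold factProd
    have h : ∏ j : Fin n, ((j.rev : ℕ).factorial : ℚ) = ∏ k ∈ range n, (k.factorial : ℚ) :=
      (Equiv.prod_comp Fin.revPerm (fun j : Fin n => ((j : ℕ).factorial : ℚ))).trans
        (Fin.prod_univ_eq_prod_range (fun j => (j.factorial : ℚ)) n)
    rw [prod_div_distrib, prod_const_one, h]
  rw [h1, h2, ← Matrix.det_mul_row]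
  unfold divVandermonde
  congr 2
  ext1 i; ext1 j
  have : ((n : ℤ) - ((j : ℕ) + 1 : ℤ)) = ((j.rev : ℕ) : ℤ) := by
    rw [Fin.val_rev]; omega
  rw [this, Matrix.projVandermonde_apply, divPow, if_pos (by simp), Int.toNat_natCast]
  simp

/-! ### Antisymmetric polynomials -/

/-- Listed in increasing order, distinct naturals satisfy `k ≤ e k`; equality of the sums forces `e
k = k`. -/
theorem lt_of_sum_eq_sum_range {m : Fin n → ℕ} (hm : Function.Injective m)
    (hs : ∑ i, m i = ∑ i : Fin n, (i : ℕ)) (i : Fin n) : m i < n := by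
  classical
  set S := univ.image m with hS
  have hc : #S = n := by rw [hS, card_image_of_injective _ hm, card_univ, Fintype.card_fin]
  set e := S.orderEmbOfFin hc with he
  have hle : ∀ k : ℕ, ∀ hk : k < n, k ≤ e ⟨k, hk⟩ := by
    intro k
    induction k with
    | zero => intro _; exact Nat.zero_le _
    | succ k ih =>
      intro hk
      have h1 := ih (by omega)
      have h2 : e ⟨k, by omega⟩ < e ⟨k + 1, hk⟩ := e.strictMono (by simp)
      omega
  have hsum : ∑ k, e k = ∑ i, m i := by
    have h1 : ∑ x ∈ S, x = ∑ i, m i := by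
      rw [hS, sum_image fun a _ b _ h => hm h]
    rw [← h1, ← map_orderEmbOfFin_univ S hc, sum_map]
    rfl
  have heq := (Finset.sum_eq_sum_iff_of_le (s := univ) (f := fun k : Fin n => (k : ℕ))
    (g := fun k => e k) fun k _ => hle k k.2).mp (by rw [hsum, hs])
  have hi : m i ∈ Set.range e := by
    rw [range_orderEmbOfFin]
    simp [hS]
  obtain ⟨k, hk⟩ := hi
  rw [← hk, ← heq k (mem_univ k)]
  exact k.2

/-- A polynomial which changes sign under odd permutations. -/
def IsAntisymmetric (p : MvPolynomial (Fin n) ℚ) : Prop :=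
  ∀ σ : Perm (Fin n), rename σ p = (Perm.sign σ : ℤ) • p

theorem IsAntisymmetric.coeff_mapDomain {p : MvPolynomial (Fin n) ℚ} (hp : IsAntisymmetric p)
    (σ : Perm (Fin n)) (m : Fin n →₀ ℕ) :
    coeff m p = (Perm.sign σ : ℤ) • coeff (m.mapDomain σ) p := by
  rw [← MvPolynomial.coeff_rename_mapDomain σ σ.injective p m, hp σ, ← MvPolynomial.coeff_smul]

/-- Equal exponents make a coefficient equal to its own negative. Distinct exponents of this total
degree are a permutation of `0, …, n - 1`, so the coefficient agrees up to sign with the one assumed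
to vanish. -/
theorem IsAntisymmetric.eq_zero {p : MvPolynomial (Fin n) ℚ} (hp : IsAntisymmetric p)
    (hh : p.IsHomogeneous (∑ i : Fin n, (i : ℕ)))
    (h0 : coeff (Finsupp.equivFunOnFinite.symm fun i : Fin n => (i.rev : ℕ)) p = 0) : p = 0 := by
  ext m
  rw [MvPolynomial.coeff_zero]
  by_contra hne
  have hdeg : ∑ i, m i = ∑ i : Fin n, (i : ℕ) := by
    have := hh hne
    rw [← this, Finsupp.weight_apply, Finsupp.sum_fintype] <;> simp
  have hinj : Function.Injective m := by
    intro i j hij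
    by_contra hne'
    have h1 := hp.coeff_mapDomain (swap i j) m
    have h2 : m.mapDomain (swap i j) = m := by
      ext k
      rw [← swap_apply_self i j k, Finsupp.mapDomain_apply (swap i j).injective, swap_apply_self,
        swap_apply_def]
      split_ifs with e1 e2
      · rw [e1, hij]
      · rw [e2, hij]
      · rfl
    rw [h2, Perm.sign_swap hne'] at h1
    apply hne
    simp at h1
    linarith
  have hlt := lt_of_sum_eq_sum_range hinj hdeg
  set τ : Perm (Fin n) := Equiv.ofBijective (fun i => ⟨m i, hlt i⟩)
    (Finite.injective_iff_bijective.mp fun i j h => hinj (by simpa using h)) with hτ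
  have hτm : ∀ i, ((τ i : Fin n) : ℕ) = m i := fun i => rfl
  set σ : Perm (Fin n) := τ.trans Fin.revPerm with hσ
  have := hp.coeff_mapDomain σ m
  have h2 : m.mapDomain σ = Finsupp.equivFunOnFinite.symm fun i : Fin n => (i.rev : ℕ) := by
    ext k
    rw [← σ.apply_symm_apply k, Finsupp.mapDomain_apply σ.injective, ← hτm]
    simp [hσ]
  rw [h2, h0] at this
  simp at this
  exact hne this

theorem isAntisymmetric_of_adjacent {p : MvPolynomial (Fin n) ℚ}
    (h : ∀ k k' : Fin n, (k : ℕ) + 1 = k' → rename (swap k k') p = -p) : IsAntisymmetric p := by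
  intro σ
  cases n with
  | zero =>
    rw [Subsingleton.elim σ 1]
    simp
  | succ n =>
    have hσ : σ ∈ Submonoid.closure (Set.range fun i : Fin n ↦ swap i.castSucc i.succ) := by
      rw [Perm.mclosure_swap_castSucc_succ]; trivial
    induction hσ using Submonoid.closure_induction with
    | mem x hx =>
      obtain ⟨i, rfl⟩ := hx
      rw [h _ _ (by simp), Perm.sign_swap (Fin.castSucc_lt_succ).ne]
      simp
    | one => simp
    | mul x y _ _ hx hy =>
      rw [Perm.coe_mul, ← MvPolynomial.rename_rename, hy, map_zsmul, hx, smul_smul]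
      simp [mul_comm]

theorem vandermonde_isAntisymmetric (n : ℕ) : IsAntisymmetric (divVandermonde n) := by
  intro σ
  unfold divVandermonde
  have h1 := Matrix.det_permute σ
    (Matrix.of fun i j : Fin n => divPow (X i) ((n : ℤ) - ((j : ℕ) + 1 : ℤ)))
  have h2 : rename σ (Matrix.det
      (Matrix.of fun i j : Fin n => divPow (X i) ((n : ℤ) - ((j : ℕ) + 1 : ℤ)))) =
      ((Matrix.of fun i j : Fin n => divPow (X i : MvPolynomial (Fin n) ℚ)
        ((n : ℤ) - ((j : ℕ) + 1 : ℤ))).submatrix σ id).det := by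
    rw [AlgHom.map_det]
    congr 1
    refine Matrix.ext fun i j => ?_
    simp only [AlgHom.mapMatrix_apply, Matrix.map_apply, Matrix.of_apply, Matrix.submatrix_apply,
      id, divPow]
    split_ifs <;> simp
  rw [h2, h1, zsmul_eq_mul]

theorem divVandermonde_isHomogeneous (n : ℕ) :
    (divVandermonde n).IsHomogeneous (∑ i : Fin n, (i : ℕ)) := by
  unfold divVandermonde
  rw [Matrix.det_apply']
  refine MvPolynomial.IsHomogeneous.sum _ _ _ fun σ _ => ?_
  have : ((Perm.sign σ : ℤ) : MvPolynomial (Fin n) ℚ) = C ((Perm.sign σ : ℤ) : ℚ) := by simp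
  rw [this]
  refine MvPolynomial.IsHomogeneous.C_mul ?_ _
  have h1 : ∑ i : Fin n, (i : ℕ) = ∑ i : Fin n, (i.rev : ℕ) :=
    (Equiv.sum_comp Fin.revPerm (fun i : Fin n => (i : ℕ))).symm
  rw [h1]
  refine MvPolynomial.IsHomogeneous.prod _ _ _ fun i _ => ?_
  have : ((n : ℤ) - ((i : ℕ) + 1 : ℤ)) = ((i.rev : ℕ) : ℤ) := by
    rw [Fin.val_rev]; omega
  rw [Matrix.of_apply, this, divPow, if_pos (by simp), Int.toNat_natCast]
  exact (MvPolynomial.isHomogeneous_X_pow _ _).C_mul _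

theorem degPoly_isHomogeneous (w : Perm (Fin n)) : (degPoly w).IsHomogeneous (length w) := by
  rw [degPoly_eq_chainSum]
  refine MvPolynomial.IsHomogeneous.C_mul ?_ _
  refine MvPolynomial.IsHomogeneous.sum _ _ _ fun c _ => ?_
  have : length w = ∑ _i : Fin (length w), 1 := by simp
  refine Eq.subst (motive := MvPolynomial.IsHomogeneous _) this.symm ?_
  refine MvPolynomial.IsHomogeneous.prod _ _ _ fun i _ => ?_
  unfold edgeWeight
  refine MvPolynomial.IsHomogeneous.sum _ _ _ fun p _ => ?_
  exact (MvPolynomial.isHomogeneous_X _ _).sub (MvPolynomial.isHomogeneous_X _ _)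

theorem length_longest (n : ℕ) : length (longest n) = ∑ i : Fin n, (i : ℕ) := by
  unfold length
  have : ({p : Fin n × Fin n | p.1 < p.2 ∧ longest n p.2 < longest n p.1} : Finset _) =
      univ.filter fun p : Fin n × Fin n => p.1 < p.2 := by
    ext p; simp [longest]
  rw [this, card_filter, Fintype.sum_prod_type_right]
  refine sum_congr rfl fun j _ => ?_
  rw [← card_filter, ← Fin.card_Iio]
  congr 1
  ext i; simp

/-! ### Dominant permutations -/

/-- The inequalities that say that `v` avoids `132`. -/
def Dominant (v : Perm (Fin n)) : Prop :=
  ∀ a b c, a < b → b < c → ¬ (v a < v c ∧ v c < v b)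

theorem Dominant.swap {v : Perm (Fin n)} {r s : Fin n} (hv : Dominant v)
    (h : IsLastDescent v r s) : Dominant (v * Equiv.swap r s) := by
  rintro a b c hab hbc ⟨h1, h2⟩
  have hrs := h.lt
  have hv' := h.val_lt
  have hbr : b ≤ r := by
    by_contra hcon
    have := h.swap_incr (not_le.mp hcon) hbc
    omega
  have va : (v * Equiv.swap r s) a = v a := by
    rcases h.swap_apply a with e | e | e <;> omega
  rw [va] at h1
  rcases h.swap_apply b with ⟨e, eb⟩ | ⟨e, eb⟩ | ⟨e, e', eb⟩ <;>
  rcases h.swap_apply c with ⟨f, ec⟩ | ⟨f, ec⟩ | ⟨f, f', ec⟩ <;> rw [ec] at h1 <;>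
  rw [eb, ec] at h2
  all_goals
    have i1 := hv a b s
    have i2 := hv a b r
    have i3 := hv a b c
    have i4 := hv a r c
    omega

theorem codegPoly_one : codegPoly (1 : Perm (Fin n)) = degPoly (longest n) := by
  rw [codegPoly, mul_one]

theorem code_one (p : Fin n) : code (1 : Perm (Fin n)) p = 0 := by
  rw [code, card_eq_zero, invSet, filter_eq_empty_iff]
  rintro j - ⟨h1, h2⟩
  exact h1.asymm h2

/-- A transition position `q` would make `q, r, s` a 132 pattern. Each step is thus one derivative
in `y_r`, matching the decrease of the code at `r` by one. -/
theorem codegPoly_of_dominant {v : Perm (Fin n)} (hv : Dominant v) :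
    codegPoly v = partialMonomial (code v) (degPoly (longest n)) := by
  classical
  induction hm : length v generalizing v with
  | zero =>
    rw [eq_one_of_length_eq_zero hm, codegPoly_one]
    have : code (1 : Perm (Fin n)) = 0 := funext code_one
    rw [this, partialMonomial_zero]
    rfl
  | succ m ih =>
    have hne : v ≠ 1 := by
      rintro rfl
      rw [length_one] at hm
      omega
    obtain ⟨r, s, h⟩ := exists_isLastDescent hne
    have hl := h.length_swap
    rw [codegPoly_transition h, ih (hv.swap h) (by omega), ← partialMonomial_add_single]
    have hcode : code (v * Equiv.swap r s) + Pi.single r 1 = code v := by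
      funext p
      by_cases hp : p = r
      · subst hp
        simp [h.code_self]
      · simp [hp, h.code_swap_of_ne hp]
    have hempty : ({q | IsTransition v r s q} : Finset (Fin n)) = ∅ := by
      rw [filter_eq_empty_iff]
      intro q _ hq
      exact hv q r s hq.1 h.lt ⟨hq.2.1, h.val_lt⟩
    rw [hempty, sum_empty, add_zero, hcode]

theorem degPoly_longest (n : ℕ) : degPoly (longest n) = divVandermonde n := by
  have hinv : longest n * longest n = 1 := by
    ext i; simp [longest]
  have hanti : ∀ i j, i < j → longest n j < longest n i := by
    intro i j hij; simpa [longest] using hij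
  have hcode : code (longest n) = fun i => (i.rev : ℕ) := by
    funext i
    have : invSet (longest n) i = Ioi i := by
      ext j
      rw [mem_invSet, mem_Ioi]
      exact ⟨fun h => h.1, fun h => ⟨h, hanti _ _ h⟩⟩
    rw [code, this, Fin.card_Ioi, Fin.val_rev]
    omega
  -- The longest element is itself 132-avoiding, and its `codegPoly` is `degPoly 1`.
  have h1 : partialMonomial (fun i : Fin n => (i.rev : ℕ)) (degPoly (longest n)) = 1 := by
    rw [← hcode, ← codegPoly_of_dominant, codegPoly, hinv, degPoly_one]
    rintro a b c hab hbc ⟨h1, h2⟩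
    have := hanti a c (hab.trans hbc)
    exact h1.asymm this
  -- After differentiation the exponent in row `i` and column `j` is `i - j`, so the matrix is lower
  -- triangular with ones on the diagonal.
  have h2 : partialMonomial (fun i : Fin n => (i.rev : ℕ)) (divVandermonde n) = 1 := by
    unfold divVandermonde
    rw [partialMonomial_det_divPow, Matrix.det_of_isLowerTriangular]
    · refine prod_eq_one fun i _ => ?_
      have : (n : ℤ) - ((i : ℕ) + 1 : ℤ) - ((i.rev : ℕ) : ℤ) = 0 := by
        rw [Fin.val_rev]; omega
      rw [Matrix.of_apply, this]
      simp [divPow]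
    · intro i j hij
      have hij' : i < j := hij
      rw [Matrix.of_apply, divPow, if_neg]
      rw [Fin.val_rev]
      rw [Fin.lt_def] at hij'
      omega
  rw [← sub_eq_zero]
  apply IsAntisymmetric.eq_zero
  · have h3 : IsAntisymmetric (degPoly (longest n)) :=
      isAntisymmetric_of_adjacent fun k k' hk =>
        rename_swap_degPoly_of_descent hk (hanti k k' (by rw [Fin.lt_def]; omega))
    intro σ
    rw [map_sub, h3 σ, vandermonde_isAntisymmetric n σ, smul_sub]
  · refine MvPolynomial.IsHomogeneous.sub ?_ (divVandermonde_isHomogeneous n)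
    rw [← length_longest]
    exact degPoly_isHomogeneous _
  · apply coeff_eq_zero_of_partialMonomial
    rw [map_sub, h1, h2, sub_self]

/-! ### Tableaux of the shape of a permutation -/

/-- The number of rows of length greater than `j` in the shape of `v`. -/
def numGt (v : Perm (Fin n)) (j : ℕ) : ℕ := #{p | j < code v p}

theorem numGt_antitone (v : Perm (Fin n)) {j j' : ℕ} (h : j ≤ j') : numGt v j' ≤ numGt v j :=
  card_le_card fun p hp => by
    rw [mem_filter] at hp ⊢
    exact ⟨hp.1, h.trans_lt hp.2⟩

/-- Flagged semistandard tableaux of the shape of `v`, where the entries in a row of length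
`code v p` are smaller than the elements of `invSet v p`. -/
structure IsTab (v : Perm (Fin n)) (T : ℕ → ℕ → ℕ) : Prop where
  zero : ∀ i j, numGt v j ≤ i → T i j = 0
  row : ∀ i j j', j < j' → i < numGt v j' → T i j ≤ T i j'
  col : ∀ i i' j, i < i' → i' < numGt v j → T i j < T i' j
  flag : ∀ p q i j, q ∈ invSet v p → i < numGt v j → i < numGt v (code v p - 1) → T i j < q

theorem code_pos_iff {v : Perm (Fin n)} {p : Fin n} : 0 < code v p ↔ (invSet v p).Nonempty :=
  card_pos

/-- Among the codes exceeding `j` a minimal one is chosen; row `i` is then at least that long, so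
the flag condition of this position applies to every cell `(i, j)` of the shape. -/
theorem exists_row {v : Perm (Fin n)} {i j : ℕ} (h : i < numGt v j) :
    ∃ p, j < code v p ∧ i < numGt v (code v p - 1) := by
  have hne : ({p | j < code v p} : Finset (Fin n)).Nonempty := by
    rw [← card_pos]; exact (Nat.zero_le _).trans_lt h
  obtain ⟨p, hp, hmin⟩ := exists_min_image _ (code v) hne
  rw [mem_filter] at hp
  refine ⟨p, hp.2, h.trans_le (card_le_card fun x hx => ?_)⟩
  have := hmin x hx
  rw [mem_filter] at hx ⊢
  refine ⟨hx.1, ?_⟩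
  omega

section Increasing
variable {v : Perm (Fin n)} {r : Fin n} (hv : ∀ a b, r < a → a < b → v a < v b)
include hv

theorem exists_mem_invSet_le_succ {p : Fin n} (hp : (invSet v p).Nonempty) :
    ∃ q ∈ invSet v p, (q : ℕ) ≤ r + 1 := by
  obtain ⟨q, hq⟩ := hp
  by_cases hqr : (q : ℕ) ≤ r + 1
  · exact ⟨q, hq, hqr⟩
  · rw [mem_invSet] at hq
    have h1 : (r : ℕ) + 1 < n := by omega
    set x : Fin n := ⟨r + 1, h1⟩ with hx
    have hx' : (x : ℕ) = r + 1 := rfl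
    refine ⟨x, mem_invSet.mpr ?_, by omega⟩
    have h2 := hv x q (by omega) (by omega)
    have h3 := hv p q
    exact ⟨by omega, by omega⟩

theorem IsTab.le {T : ℕ → ℕ → ℕ} (hT : IsTab v T) {i j : ℕ} (h : i < numGt v j) : T i j ≤ r := by
  obtain ⟨p, hp, hi⟩ := exists_row h
  obtain ⟨q, hq, hqr⟩ := exists_mem_invSet_le_succ hv (code_pos_iff.mp ((Nat.zero_le j).trans_lt hp))
  have := hT.flag p q i j hq h hi
  omega

/-- If all elements of `invSet v p` exceeded `r`, then `p < r` and `v p < v r`, so this set would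
lie in `invSet v r`, against the sizes. Consequently entries in columns from `code v r` on are
smaller than `r`. -/
theorem exists_mem_invSet_le {p : Fin n} (hp : code v r < code v p) :
    ∃ q ∈ invSet v p, q ≤ r := by
  by_contra! hcon
  have hne : (invSet v p).Nonempty := code_pos_iff.mp ((Nat.zero_le _).trans_lt hp)
  have hpr : p < r := by
    obtain ⟨q, hq⟩ := hne
    rw [mem_invSet] at hq
    have h3 := hv p q
    have : p ≠ r := by rintro rfl; omega
    omega
  have hvpr : v p < v r := by
    by_contra hc
    have hne' : v p ≠ v r := v.injective.ne hpr.ne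
    have := hcon r (mem_invSet.mpr ⟨hpr, by omega⟩)
    omega
  have : invSet v p ⊆ invSet v r := by
    intro q hq
    have h1 := hcon q hq
    rw [mem_invSet] at hq ⊢
    omega
  have := card_le_card this
  unfold code at hp
  omega

theorem IsTab.lt {T : ℕ → ℕ → ℕ} (hT : IsTab v T) {i j : ℕ} (h : i < numGt v j)
    (hj : code v r ≤ j) : T i j < r := by
  obtain ⟨p, hp, hi⟩ := exists_row h
  obtain ⟨q, hq, hqr⟩ := exists_mem_invSet_le hv (p := p) (by omega)
  have := hT.flag p q i j hq h hi
  omega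

end Increasing

/-- The inversion sets of a vexillary permutation form a chain: an element of each set missing from
the other, together with `p` and `q`, would form a 2143 pattern. -/
theorem Vex.invSet_subset {v : Perm (Fin n)} (hv : Vex v) {p q : Fin n}
    (h : code v p ≤ code v q) : invSet v p ⊆ invSet v q := by
  by_contra hcon
  rw [Finset.not_subset] at hcon
  obtain ⟨a, ha, ha'⟩ := hcon
  have : ¬ invSet v q ⊆ invSet v p := by
    intro hs
    have := eq_of_subset_of_card_le hs h
    exact ha' (this ▸ ha)
  rw [Finset.not_subset] at this
  obtain ⟨b, hb, hb'⟩ := this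
  rw [mem_invSet] at ha ha' hb hb'
  have hbp : b ≠ p → v b ≠ v p := v.injective.ne
  have haq : a ≠ q → v a ≠ v q := v.injective.ne
  rcases lt_trichotomy p q with hpq | rfl | hpq
  · have hne : a ≠ q := by rintro rfl; omega
    have := hv p a q b ha.1
    omega
  · omega
  · have hne : b ≠ p := by rintro rfl; omega
    have := hv q b p a hb.1
    omega

/-! ### Removing and adding the corner cell of the last descent -/

namespace IsLastDescent
variable {v : Perm (Fin n)} {r s : Fin n}

theorem numGt_swap_of_ne (h : IsLastDescent v r s) {j : ℕ} (hj : j ≠ code (v * swap r s) r) :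
    numGt (v * swap r s) j = numGt v j := by
  unfold numGt
  congr 1
  ext p
  simp only [mem_filter, mem_univ, true_and]
  by_cases hp : p = r
  · subst hp
    have := h.code_self
    omega
  · rw [h.code_swap_of_ne hp]

theorem numGt_self (h : IsLastDescent v r s) :
    numGt v (code (v * swap r s) r) = numGt (v * swap r s) (code (v * swap r s) r) + 1 := by
  unfold numGt
  rw [← card_insert_of_notMem (a := r)]
  · congr 1
    ext p
    simp only [mem_filter, mem_univ, true_and, mem_insert]
    by_cases hp : p = r
    · subst hp
      have := h.code_self
      simp; omega
    · rw [h.code_swap_of_ne hp]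
      simp [hp]
  · simp

/-- The corner is overwritten by 0, the value prescribed outside the shape. The exchange of `r` and
`s` can add only `r` as a stricter bound for other positions, and the rows concerned have entries
below `r`: either an old bound gives this, or they lie above the corner, whose entry is `r`. -/
theorem isTab_swap (h : IsLastDescent v r s) (T : ℕ → ℕ → ℕ) (hT : IsTab v T)
    (hr : T (numGt (v * swap r s) (code (v * swap r s) r)) (code (v * swap r s) r) = r) :
    IsTab (v * swap r s) fun i j =>
      if i = numGt (v * swap r s) (code (v * swap r s) r) ∧ j = code (v * swap r s) r then 0
      else T i j := by
  have hne := fun j => h.numGt_swap_of_ne (j := j)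
  have hself := h.numGt_self
  have hcr := h.code_self
  set u := v * swap r s with hu
  set j0 := code u r with hj0
  set i0 := numGt u j0 with hi0
  have hle : ∀ j, numGt u j ≤ numGt v j := by
    intro j
    by_cases hj : j = j0
    · subst hj; omega
    · rw [hne j hj]
  have hcell : ∀ {i j}, i < numGt u j → ¬ (i = i0 ∧ j = j0) := by
    rintro i j hij ⟨rfl, rfl⟩
    omega
  constructor
  · intro i j hij
    split_ifs with hc
    · rfl
    · apply hT.zero
      by_cases hj : j = j0
      · subst hj
        have : i ≠ i0 := fun e => hc ⟨e, rfl⟩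
        omega
      · rwa [← hne j hj]
  · intro i j j' hjj hi
    rw [if_neg (hcell hi), if_neg (hcell (hi.trans_le (numGt_antitone u hjj.le)))]
    exact hT.row i j j' hjj (hi.trans_le (hle _))
  · intro i i' j hii hi
    rw [if_neg (hcell hi), if_neg (hcell (hii.trans hi))]
    exact hT.col i i' j hii (hi.trans_le (hle _))
  · intro p q i j hq hi hi'
    rw [if_neg (hcell hi)]
    have hi1 := hi.trans_le (hle _)
    have hi2 := hi'.trans_le (hle _)
    by_cases hp : p = r
    · subst hp
      have h1 := hT.le h.incr hi1
      rw [mem_invSet] at hq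
      omega
    · rw [h.code_swap_of_ne hp] at hi' hi2
      have hpr : p < r := by
        by_contra hc
        rw [h.invSet_swap_eq_empty (by omega)] at hq
        simp at hq
      by_cases hqv : q ∈ invSet v p
      · exact hT.flag p q i j hqv hi1 hi2
      · have hq' := hq
        rw [h.invSet_swap_of_lt hpr, mem_map_equiv, symm_swap, swap_apply_def] at hq'
        have hqs : q = r ∧ s ∈ invSet v p := by
          split_ifs at hq' with e1 e2
          · exact ⟨e1, hq'⟩
          · rw [mem_invSet] at hq hq'
            have := h.lt
            have : (v * swap r s) p = v p := by
              rcases h.swap_apply p with e | e | e <;> omega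
            have : (v * swap r s) q = v r := by simp [e2]
            rw [mem_invSet] at hqv
            have := h.val_lt
            subst e2
            omega
          · exact absurd hq' hqv
        obtain ⟨rfl, hs⟩ := hqs
        have hge : code v q ≤ code v p := by
          refine card_le_card fun x hx => ?_
          rw [mem_invSet] at hs hx ⊢
          have h1 := h.lt_of_gt x
          have h2 := h.incr s x
          have h3 := h.incr x s hx.1
          have h4 : x ≠ s → v x ≠ v s := v.injective.ne
          refine ⟨by omega, ?_⟩
          by_cases e : x = s
          · subst e; omega
          · omega
        by_cases hj : code v q ≤ j
        · exact hT.lt h.incr hi1 hj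
        · rcases hge.lt_or_eq with hlt | heq
          · obtain ⟨q', hq1, hq2⟩ := exists_mem_invSet_le h.incr hlt
            have := hT.flag p q' i j hq1 hi1 hi2
            omega
          · have e1 : code v p - 1 = j0 := by omega
            rw [e1] at hi'
            have h1 : T i j0 < T i0 j0 := hT.col i i0 j0 hi' (by omega)
            rcases (show j ≤ j0 by omega).lt_or_eq with hj' | hj'
            · have := hT.row i j j0 hj' (by omega)
              omega
            · rw [hj']; omega

/-- All old entries are at most `r`, so only flag bounds `q ≤ r` matter. By nesting of the inversion
sets these come from codes larger than `code v r`, hence concern rows other than the corner row, and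
they are present before the cell is added. -/
theorem isTab_of_swap (h : IsLastDescent v r s) (hvex : Vex v) (T : ℕ → ℕ → ℕ)
    (hT : IsTab (v * swap r s) T) :
    IsTab v fun i j =>
      if i = numGt (v * swap r s) (code (v * swap r s) r) ∧ j = code (v * swap r s) r then r
      else T i j := by
  have hne := fun j => h.numGt_swap_of_ne (j := j)
  have hself := h.numGt_self
  have hcr := h.code_self
  have hincr : ∀ a b, r < a → a < b → (v * swap r s) a < (v * swap r s) b :=
    fun a b => h.swap_incr
  have hcp := fun p => h.code_swap_of_ne (p := p)
  have hlt := fun p => h.invSet_swap_of_lt (p := p)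
  set u := v * swap r s with hu
  set j0 := code u r with hj0
  set i0 := numGt u j0 with hi0
  have hcell : ∀ {i j}, i < numGt v j → ¬ (i = i0 ∧ j = j0) → i < numGt u j := by
    intro i j hij hc
    by_cases hj : j = j0
    · subst hj
      have : i ≠ i0 := fun e => hc ⟨e, rfl⟩
      omega
    · rwa [hne j hj]
  constructor
  · intro i j hij
    rw [if_neg]
    · apply hT.zero
      by_cases hj : j = j0
      · subst hj; omega
      · rwa [hne j hj]
    · rintro ⟨rfl, rfl⟩; omega
  · intro i j j' hjj hi
    by_cases hc' : i = i0 ∧ j' = j0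
    · rw [if_pos hc', if_neg (by omega)]
      exact hT.le hincr (hcell (hi.trans_le (numGt_antitone v hjj.le)) (by omega))
    · rw [if_neg hc', if_neg]
      · exact hT.row i j j' hjj (hcell hi hc')
      · rintro ⟨rfl, rfl⟩
        have := hcell hi hc'
        have := numGt_antitone u hjj.le
        omega
  · intro i i' j hii hi
    by_cases hc' : i' = i0 ∧ j = j0
    · rw [if_pos hc', if_neg (by omega)]
      exact hT.lt hincr (hcell (hii.trans hi) (by omega)) (by omega)
    · rw [if_neg hc', if_neg]
      · exact hT.col i i' j hii (hcell hi hc')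
      · rintro ⟨rfl, rfl⟩
        omega
  · intro p q i j hq hi hi'
    have hle : (if i = i0 ∧ j = j0 then (r : ℕ) else T i j) ≤ r := by
      split_ifs with hc
      · exact le_rfl
      · exact hT.le hincr (hcell hi hc)
    by_cases hqr : r < q
    · omega
    · have hlarge : code v r < code v p := by
        by_contra hc
        have := hvex.invSet_subset (not_lt.mp hc) hq
        rw [mem_invSet] at this
        omega
      have hi2 : i < numGt u (code v p - 1) := by rwa [hne _ (by omega)]
      have hc : ¬ (i = i0 ∧ j = j0) := by
        rintro ⟨rfl, -⟩
        have := numGt_antitone u (show j0 ≤ code v p - 1 by omega)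
        omega
      rw [if_neg hc]
      have hq' := mem_invSet.mp hq
      have hpr : p < r := by
        have : p ≠ r := by rintro rfl; omega
        omega
      refine hT.flag p q i j ?_ (hcell hi hc) (by rwa [hcp p hpr.ne])
      rw [hlt p hpr, mem_map_equiv, symm_swap]
      have hrs := h.lt
      have hvl := h.val_lt
      by_cases e : q = r
      · subst e
        rw [swap_apply_left, mem_invSet]
        omega
      · rwa [swap_apply_of_ne_of_ne e (by omega)]

end IsLastDescent

/-! ### Inversion sets and tableaux under a transition -/

namespace IsTransition
variable {v : Perm (Fin n)} {r s q : Fin n}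

/-- A value strictly between `v q` and `v s` is impossible to the right of `q` by the transition
condition, and to the left of `q` because `p, q, r, s` would form 2143. -/
theorem not_val_lt (hq : IsTransition v r s q) (h : IsLastDescent v r s) (hvex : Vex v)
    {p : Fin n} (hpq : p ≠ q) (hpr : p < r) : v q < v p ↔ v s < v p := by
  have h1 := hq.2.1
  constructor
  · intro hp
    rcases lt_or_gt_of_ne hpq with hlt | hgt
    · have := hvex p q r s hlt hq.1 h.lt
      have h2 := h.val_lt
      have h3 : v p ≠ v s := v.injective.ne (by have := h.lt; omega)
      omega
    · have := hq.2.2 p hgt hpr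
      have h3 : v p ≠ v s := v.injective.ne (by have := h.lt; omega)
      omega
  · intro hp
    omega

theorem invSet_transition_of_lt (hq : IsTransition v r s q) (h : IsLastDescent v r s)
    (hvex : Vex v) {p : Fin n} (hpr : p < r) (hpq : p ≠ q) :
    invSet (v * Equiv.swap r s * Equiv.swap q r) p =
      (invSet v p).map (Equiv.swap r s).toEmbedding := by
  have hiff := hq.not_val_lt h hvex hpq hpr
  have h1 := hq.1
  have h2 := h.lt
  have h3 := h.val_lt
  have ep : (v * Equiv.swap r s * Equiv.swap q r) p = v p := by
    rcases hq.apply h p with e | e | e | e <;> omega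
  ext j
  rw [mem_map_equiv, symm_swap, mem_invSet, mem_invSet, ep, swap_apply_def]
  have h4 := hq.2.1
  rcases hq.apply h j with e | e | e | e
  · rw [e.2, if_pos e.1, e.1]; omega
  · rw [e.2, if_neg (by omega), if_pos e.1, e.1]; omega
  · rw [e.2, if_neg (by omega), if_neg (by omega), e.1]; omega
  · rw [if_neg e.1, if_neg e.2.1]; omega

theorem invSet_transition_eq_empty (hq : IsTransition v r s q) (h : IsLastDescent v r s)
    {p : Fin n} (hpr : r < p) : invSet (v * Equiv.swap r s * Equiv.swap q r) p = ∅ := by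
  ext j
  have := @incr _ _ _ _ _ hq h p j hpr
  simp only [mem_invSet, notMem_empty, iff_false]
  omega

theorem invSet_transition_last (hq : IsTransition v r s q) (h : IsLastDescent v r s)
    (hvex : Vex v) : invSet (v * Equiv.swap r s * Equiv.swap q r) r = invSet v q := by
  have h1 := hq.1
  have h2 := h.lt
  have h3 := h.val_lt
  have h4 := hq.2.1
  have er : (v * Equiv.swap r s * Equiv.swap q r) r = v q := by
    rcases hq.apply h r with e | e | e | e <;> omega
  ext j
  rw [mem_invSet, mem_invSet, er]
  have h5 := hvex q j r s
  rcases hq.apply h j with e | e | e | e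
  · rw [e.2, e.1]; omega
  · rw [e.2, e.1]; omega
  · rw [e.2, e.1]; omega
  · rw [e.2.2.2]; omega

theorem invSet_transition_self (hq : IsTransition v r s q) (h : IsLastDescent v r s)
    (hvex : Vex v) :
    invSet (v * Equiv.swap r s * Equiv.swap q r) q = insert r ((invSet v r).erase s) := by
  have h1 := hq.1
  have h2 := h.lt
  have h3 := h.val_lt
  have h4 := hq.2.1
  have eq' : (v * Equiv.swap r s * Equiv.swap q r) q = v s := by
    rcases hq.apply h q with e | e | e | e <;> omega
  ext j
  rw [mem_insert, mem_erase, mem_invSet, mem_invSet, eq']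
  have h5 := hvex q j r s
  have h6 := hq.2.2 j
  have h7 := h.lt_of_gt j
  have h8 := h.incr j s
  have h9 : j ≠ q → v j ≠ v q := v.injective.ne
  rcases hq.apply h j with e | e | e | e
  · rw [e.2, e.1]; omega
  · rw [e.2, e.1]; omega
  · rw [e.2, e.1]; omega
  · rw [e.2.2.2]; omega

/-- The transition exchanges the codes at `q` and `r`, hence preserves the shape. Only the flag
changes: the set moved from `r` to `q` loses `s` and gains `r`. -/
theorem code_transition (hq : IsTransition v r s q) (h : IsLastDescent v r s) (hvex : Vex v)
    (p : Fin n) :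
    code (v * Equiv.swap r s * Equiv.swap q r) p = code v (Equiv.swap q r p) := by
  have h1 := hq.1
  by_cases hpq : p = q
  · subst hpq
    have hs := h.mem_invSet_self
    rw [swap_apply_left, code, hq.invSet_transition_self h hvex, card_insert_of_notMem, code,
      card_erase_add_one hs]
    simp [mem_invSet]
  · by_cases hpr : p = r
    · subst hpr
      rw [swap_apply_right, code, hq.invSet_transition_last h hvex, code]
    · rw [swap_apply_of_ne_of_ne hpq hpr]
      unfold code
      rcases lt_or_gt_of_ne hpr with hlt | hgt
      · rw [hq.invSet_transition_of_lt h hvex hlt hpq, card_map]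
      · rw [hq.invSet_transition_eq_empty h hgt, h.invSet_eq_empty hgt]

theorem numGt_transition (hq : IsTransition v r s q) (h : IsLastDescent v r s) (hvex : Vex v)
    (j : ℕ) : numGt (v * Equiv.swap r s * Equiv.swap q r) j = numGt v j := by
  unfold numGt
  rw [← card_map (Equiv.swap q r).toEmbedding]
  congr 1
  ext p
  simp only [mem_map_equiv, symm_swap, mem_filter, mem_univ, true_and,
    hq.code_transition h hvex, swap_apply_self]

theorem code_lt (hq : IsTransition v r s q) (h : IsLastDescent v r s) (hvex : Vex v) :
    code v q < code v r := by
  refine card_lt_card ((Finset.ssubset_iff_of_subset ?_).mpr ⟨s, h.mem_invSet_self, ?_⟩)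
  · rw [← hq.invSet_transition_last h hvex]
    intro j hj
    rw [hq.invSet_transition_last h hvex] at hj
    have h1 := hq.1
    have h2 := h.lt
    have h3 := h.val_lt
    have h4 := hq.2.1
    have h5 := hvex q j r s
    rw [mem_invSet] at hj ⊢
    have : j ≠ r := by rintro rfl; omega
    omega
  · rw [mem_invSet]
    have := hq.2.1
    omega

/-- A corner entry different from `r` is smaller than `r`, and monotonicity extends this to all rows
down to the corner row. This is the bound contributed by the new element `r` of the inversion set at
`q`. Conversely, that bound excludes `r` from the corner, and the old bounds not exceeding `r` are
kept. -/
theorem isTab_iff (hq : IsTransition v r s q) (h : IsLastDescent v r s) (hvex : Vex v)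
    (T : ℕ → ℕ → ℕ) :
    IsTab v T ∧ T (numGt (v * Equiv.swap r s) (code (v * Equiv.swap r s) r))
        (code (v * Equiv.swap r s) r) ≠ r ↔
      IsTab (v * Equiv.swap r s * Equiv.swap q r) T := by
  have hself := h.numGt_self
  have hcr := h.code_self
  set j0 := code (v * Equiv.swap r s) r with hj0
  set i0 := numGt (v * Equiv.swap r s) j0 with hi0
  have hN := hq.numGt_transition h hvex
  have hc := hq.code_transition h hvex
  have hincr : ∀ a b, r < a → a < b → (v * Equiv.swap r s * Equiv.swap q r) a <
      (v * Equiv.swap r s * Equiv.swap q r) b := fun a b => hq.incr h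
  have hone := fun p => hq.invSet_transition_of_lt h hvex (p := p)
  have hemp := fun p => hq.invSet_transition_eq_empty h (p := p)
  have hlast := hq.invSet_transition_last h hvex
  have hqq := hq.invSet_transition_self h hvex
  have hqr := hq.1
  have hrs := h.lt
  have hcq : code (v * Equiv.swap r s * Equiv.swap q r) q = code v r := by
    rw [hc, swap_apply_left]
  have hcrr : code (v * Equiv.swap r s * Equiv.swap q r) r = code v q := by
    rw [hc, swap_apply_right]
  have hcp : ∀ p, p ≠ q → p ≠ r → code (v * Equiv.swap r s * Equiv.swap q r) p = code v p := by
    intro p h1 h2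
    rw [hc, swap_apply_of_ne_of_ne h1 h2]
  set t := v * Equiv.swap r s * Equiv.swap q r with ht
  constructor
  · rintro ⟨hT, hne⟩
    have hlt0 : T i0 j0 < r := lt_of_le_of_ne (hT.le h.incr (by omega)) hne
    have hlt : ∀ i j, i < numGt v j → i ≤ i0 → T i j < r := by
      intro i j hij hi
      by_cases hj : j0 < j
      · exact hT.lt h.incr hij (by omega)
      · have h1 : T i j ≤ T i j0 := by
          rcases (not_lt.mp hj).lt_or_eq with hj | hj
          · exact hT.row i j j0 hj (by omega)
          · rw [hj]
        have h2 : T i j0 ≤ T i0 j0 := by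
          rcases hi.lt_or_eq with hi | hi
          · exact (hT.col i i0 j0 hi (by omega)).le
          · rw [hi]
        omega
    refine ⟨fun i j hij => hT.zero i j (by rwa [hN] at hij),
      fun i j j' hjj hi => hT.row i j j' hjj (by rwa [hN] at hi),
      fun i i' j hii hi => hT.col i i' j hii (by rwa [hN] at hi), ?_⟩
    intro p q' i j hq' hi hi'
    rw [hN] at hi hi'
    by_cases hpr : p = r
    · subst hpr
      rw [hlast] at hq'
      rw [hcrr] at hi'
      exact hT.flag _ _ i j hq' hi hi'
    · by_cases hpq : p = q
      · subst hpq
        rw [hcq] at hi'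
        rw [hqq, mem_insert, mem_erase] at hq'
        rcases hq' with rfl | hq'
        · refine hlt i j hi ?_
          rw [hcr, Nat.add_sub_cancel] at hi'
          omega
        · exact hT.flag _ _ i j hq'.2 hi hi'
      · rw [hcp p hpq hpr] at hi'
        have hplt : p < r := by
          by_contra hcon
          rw [hemp p (by omega)] at hq'
          simp at hq'
        by_cases hqv : q' ∈ invSet v p
        · exact hT.flag p q' i j hqv hi hi'
        · rw [hone p hplt hpq, mem_map_equiv, symm_swap, swap_apply_def] at hq'
          have hval := h.val_lt
          split_ifs at hq' with e1 e2
          · subst e1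
            have hge : code v q' ≤ code v p := by
              refine card_le_card fun x hx => ?_
              rw [mem_invSet] at hq' hx ⊢
              have h1 := h.lt_of_gt x
              have h3 := h.incr x s hx.1
              by_cases e : x = s
              · subst e; omega
              · omega
            refine hlt i j hi ?_
            have := numGt_antitone v (show j0 ≤ code v p - 1 by omega)
            omega
          · subst e2
            rw [mem_invSet] at hq' hqv
            omega
          · exact absurd hq' hqv
  · intro hT
    refine ⟨⟨fun i j hij => hT.zero i j (by rwa [hN]),
      fun i j j' hjj hi => hT.row i j j' hjj (by rwa [hN]),
      fun i i' j hii hi => hT.col i i' j hii (by rwa [hN]), ?_⟩, ?_⟩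
    · intro p q' i j hq' hi hi'
      have hle : T i j ≤ r := hT.le hincr (by rwa [hN])
      by_cases hrq : r < q'
      · omega
      · rw [← hN] at hi hi'
        have hq'' := mem_invSet.mp hq'
        have hpr : p ≠ r := by rintro rfl; omega
        by_cases hpq : p = q
        · subst hpq
          exact hT.flag r q' i j (by rwa [hlast]) hi (by rwa [hcrr])
        · refine hT.flag p q' i j ?_ hi (by rwa [hcp p hpq hpr])
          rw [hone p (by omega) hpq, mem_map_equiv, symm_swap]
          have hvl := h.val_lt
          by_cases e : q' = r
          · subst e
            rw [swap_apply_left, mem_invSet]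
            omega
          · rwa [swap_apply_of_ne_of_ne e (by omega)]
    · refine (hT.flag q r i0 j0 ?_ ?_ ?_).ne
      · rw [hqq]; exact mem_insert_self _ _
      · rw [hN]; omega
      · rw [hN, hcq, hcr, Nat.add_sub_cancel]; omega

end IsTransition

theorem IsTab.le_entry {v : Perm (Fin n)} {T : ℕ → ℕ → ℕ} (hT : IsTab v T) {i j : ℕ}
    (h : i < numGt v j) : i ≤ T i j := by
  induction i with
  | zero => exact Nat.zero_le _
  | succ i ih =>
    have h1 := ih (by omega)
    have h2 := hT.col i (i + 1) j (by omega) h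
    omega

/-- Without a transition all values to the left of `r` exceed `v s`, so `invSet v r` lies in `invSet
v p` for all `p ≤ r`. The column of the corner then has at least `r + 1` rows; strictness down this
column forces the entry to be at least `r`, and it is never larger. -/
theorem IsLastDescent.corner_eq_of_no_transition {v : Perm (Fin n)} {r s : Fin n}
    (h : IsLastDescent v r s) (hno : ∀ q, ¬ IsTransition v r s q) {T : ℕ → ℕ → ℕ}
    (hT : IsTab v T) : T (numGt (v * swap r s) (code (v * swap r s) r))
      (code (v * swap r s) r) = r := by
  have hself := h.numGt_self
  have hcr := h.code_self
  set j0 := code (v * Equiv.swap r s) r with hj0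
  set i0 := numGt (v * Equiv.swap r s) j0 with hi0
  have hgt : ∀ p, p < r → v s < v p := by
    by_contra! hcon
    obtain ⟨p, hp, hps⟩ := hcon
    have hne : ({p | p < r ∧ v p ≤ v s} : Finset (Fin n)).Nonempty := ⟨p, by simp [hp, hps]⟩
    have hm := max'_mem _ hne
    have hmax := fun k hk => le_max' ({p | p < r ∧ v p ≤ v s} : Finset (Fin n)) k hk
    -- The last position to the left of `r` with a value at most `v s` would be a transition.
    set q := ({p | p < r ∧ v p ≤ v s} : Finset (Fin n)).max' hne
    rw [mem_filter] at hm
    have hqs : v q ≠ v s := v.injective.ne (by have := h.lt; omega)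
    refine hno q ⟨hm.2.1, by omega, fun k h1 h2 h3 => ?_⟩
    have := hmax k (by rw [mem_filter]; exact ⟨mem_univ _, h2, by omega⟩)
    omega
  have hcard : (r : ℕ) + 1 ≤ numGt v j0 := by
    rw [← Fin.card_Iic]
    refine card_le_card fun p hp => ?_
    rw [mem_Iic] at hp
    rw [mem_filter]
    refine ⟨mem_univ _, ?_⟩
    have : code v r ≤ code v p := by
      rcases hp.lt_or_eq with hp | hp
      · refine card_le_card fun x hx => ?_
        have h1 := hgt p hp
        rw [mem_invSet] at hx ⊢
        have h2 := h.lt_of_gt x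
        have h3 := h.incr x s hx.1
        by_cases e : x = s
        · subst e; omega
        · omega
      · rw [hp]
    omega
  have h1 := hT.le_entry (show i0 < numGt v j0 by omega)
  have h2 := hT.le h.incr (show i0 < numGt v j0 by omega)
  omega

/-! ### The generating function of tableaux -/

/-- The cells of the shape of `v`. -/
def cells (v : Perm (Fin n)) : Finset (ℕ × ℕ) :=
  (range n ×ˢ range n).filter fun c => c.1 < numGt v c.2

theorem mem_cells {v : Perm (Fin n)} {c : ℕ × ℕ} : c ∈ cells v ↔ c.1 < numGt v c.2 := by
  rw [cells, mem_filter, and_iff_right_iff_imp]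
  intro h
  rw [mem_product, mem_range, mem_range]
  have h1 : numGt v c.2 ≤ n := (card_le_univ _).trans (by simp)
  obtain ⟨p, hp, -⟩ := exists_row h
  have h2 : code v p ≤ n := (card_le_univ _).trans (by simp)
  omega

theorem setOf_isTab_finite (v : Perm (Fin n)) : {T | IsTab v T}.Finite := by
  have hfin : {f : cells v → ℕ | ∀ c, f c ∈ Set.Iic n}.Finite :=
    Set.Finite.pi' fun c => Set.finite_Iic _
  refine Set.Finite.of_finite_image (f := fun (T : ℕ → ℕ → ℕ) (c : cells v) => T c.1.1 c.1.2)
    (hfin.subset ?_) ?_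
  · rintro _ ⟨T, hT, rfl⟩ ⟨c, hc⟩
    rw [mem_cells] at hc
    obtain ⟨p, hp, hi⟩ := exists_row hc
    obtain ⟨q, hq⟩ := code_pos_iff.mp ((Nat.zero_le _).trans_lt hp)
    have := IsTab.flag hT p q _ _ hq hc hi
    exact (this.trans q.2).le
  · intro T hT T' hT' h
    funext i j
    by_cases hc : (i, j) ∈ cells v
    · exact congrFun h ⟨(i, j), hc⟩
    · rw [mem_cells, not_lt] at hc
      rw [IsTab.zero hT i j hc, IsTab.zero hT' i j hc]

/-- The generating function of `IsTab v`. -/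
def tabPoly (v : Perm (Fin n)) : MvPolynomial ℕ ℚ :=
  ∑ T ∈ (setOf_isTab_finite v).toFinset, ∏ c ∈ cells v, X (T c.1 c.2)

theorem IsLastDescent.cells_eq {v : Perm (Fin n)} {r s : Fin n} (h : IsLastDescent v r s) :
    cells v = insert (numGt (v * swap r s) (code (v * swap r s) r), code (v * swap r s) r)
      (cells (v * swap r s)) := by
  ext ⟨i, j⟩
  have := h.numGt_self
  rw [mem_insert, mem_cells, mem_cells, Prod.mk.injEq]
  by_cases hj : j = code (v * swap r s) r
  · subst hj; simp only [and_true]; omega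
  · rw [h.numGt_swap_of_ne hj]; tauto

theorem IsLastDescent.corner_notMem {v : Perm (Fin n)} {r s : Fin n} :
    (numGt (v * swap r s) (code (v * swap r s) r), code (v * swap r s) r) ∉
      cells (v * swap r s) := by
  rw [mem_cells]; simp

-- Tableaux are separated by whether the corner contains `r`. If so, removing the corner accounts
-- for the factor `X r`; the others are the tableaux of the unique transition, or do not exist when
-- there is none.
open Classical in
theorem tabPoly_transition {v : Perm (Fin n)} {r s : Fin n} (hvex : Vex v)
    (h : IsLastDescent v r s) :
    tabPoly v = X (r : ℕ) * tabPoly (v * swap r s) +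
      ∑ q with IsTransition v r s q, tabPoly (v * swap r s * swap q r) := by
  have hcells := h.cells_eq
  have hnot := IsLastDescent.corner_notMem (v := v) (r := r) (s := s)
  have hself := h.numGt_self
  have t1 := h.isTab_swap
  have t2 := h.isTab_of_swap hvex
  have t3 := fun T => h.corner_eq_of_no_transition (T := T)
  have t4 := fun q hq => IsTransition.isTab_iff (q := q) hq h hvex
  set u := v * swap r s with hu
  set j0 := code u r with hj0
  set i0 := numGt u j0 with hi0
  conv_lhs => rw [tabPoly, ← sum_filter_add_sum_filter_not _ (fun T : ℕ → ℕ → ℕ => T i0 j0 = r)]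
  congr 1
  · rw [tabPoly, mul_sum]
    refine Finset.sum_bij' (fun T _ i j => if i = i0 ∧ j = j0 then 0 else T i j)
      (fun T _ i j => if i = i0 ∧ j = j0 then (r : ℕ) else T i j) ?_ ?_ ?_ ?_ ?_
    · intro T hT
      rw [mem_filter, Set.Finite.mem_toFinset] at hT
      rw [Set.Finite.mem_toFinset]
      exact t1 T hT.1 hT.2
    · intro T hT
      rw [Set.Finite.mem_toFinset] at hT
      rw [mem_filter, Set.Finite.mem_toFinset]
      exact ⟨t2 T hT, by simp⟩
    · intro T hT
      rw [mem_filter, Set.Finite.mem_toFinset] at hT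
      funext i j
      dsimp only
      split_ifs with hc
      · rw [hc.1, hc.2, hT.2]
      · rfl
    · intro T hT
      rw [Set.Finite.mem_toFinset] at hT
      funext i j
      dsimp only
      split_ifs with hc
      · rw [hc.1, hc.2, IsTab.zero hT i0 j0 le_rfl]
      · rfl
    · intro T hT
      rw [mem_filter, Set.Finite.mem_toFinset] at hT
      rw [hcells, prod_insert hnot, hT.2]
      congr 1
      refine prod_congr rfl fun c hc => ?_
      dsimp only
      rw [if_neg]
      rintro ⟨e1, e2⟩
      exact hnot (by rw [← e1, ← e2]; exact hc)
  · by_cases hex : ∃ q, IsTransition v r s q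
    · obtain ⟨q, hq⟩ := hex
      have hfil : ({q | IsTransition v r s q} : Finset (Fin n)) = {q} := by
        ext q'
        simp only [mem_filter, mem_univ, true_and, mem_singleton]
        exact ⟨fun hq' => IsTransition.unique hvex h hq' hq, fun e => e ▸ hq⟩
      rw [hfil, sum_singleton, tabPoly]
      refine sum_congr ?_ fun T _ => prod_congr ?_ fun _ _ => rfl
      · ext T
        rw [mem_filter, Set.Finite.mem_toFinset, Set.Finite.mem_toFinset]
        exact t4 q hq T
      · ext c
        rw [mem_cells, mem_cells, hq.numGt_transition h hvex]
    · push Not at hex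
      rw [sum_eq_zero, sum_eq_zero]
      · intro q hq
        rw [mem_filter] at hq
        exact absurd hq.2 (hex q)
      · intro T hT
        rw [mem_filter, Set.Finite.mem_toFinset] at hT
        exact absurd (t3 T hex hT.1) hT.2

theorem tabPoly_one : tabPoly (1 : Perm (Fin n)) = 1 := by
  have hN : ∀ j, numGt (1 : Perm (Fin n)) j = 0 := by
    intro j
    rw [numGt, card_eq_zero, filter_eq_empty_iff]
    intro p _
    rw [code_one]; omega
  have hc : cells (1 : Perm (Fin n)) = ∅ := by
    ext c; rw [mem_cells, hN]; simp
  have hs : (setOf_isTab_finite (1 : Perm (Fin n))).toFinset = {fun _ _ => 0} := by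
    ext T
    rw [Set.Finite.mem_toFinset, mem_singleton]
    constructor
    · intro hT
      funext i j
      exact IsTab.zero hT i j (by rw [hN]; omega)
    · rintro rfl
      refine ⟨fun _ _ _ => rfl, fun _ _ _ _ _ => le_rfl, fun i i' j _ hi => ?_,
        fun p q i j _ hi => ?_⟩
      · rw [hN] at hi; omega
      · rw [hN] at hi; omega
  rw [tabPoly, hc, hs]
  simp

/-- The termination measure of the transitions. -/
def codeWeight (v : Perm (Fin n)) : ℕ := ∑ p : Fin n, (p + 1) * code v p

/-- The weight `p + 1`, rather than `p`, makes the decrease strict also for `r = 0`. -/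
theorem IsLastDescent.codeWeight_lt {v : Perm (Fin n)} {r s : Fin n} (h : IsLastDescent v r s) :
    codeWeight (v * swap r s) < codeWeight v := by
  refine sum_lt_sum (fun p _ => ?_) ⟨r, mem_univ _, ?_⟩
  · by_cases hp : p = r
    · subst hp; rw [h.code_self]; gcongr; omega
    · rw [h.code_swap_of_ne hp]
  · rw [h.code_self]; gcongr; omega

/-- A transition preserves the length, so another measure is needed: it moves the larger code from
`r` to the earlier position `q`. -/
theorem IsTransition.codeWeight_lt {v : Perm (Fin n)} {r s q : Fin n} (hq : IsTransition v r s q)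
    (h : IsLastDescent v r s) (hvex : Vex v) :
    codeWeight (v * Equiv.swap r s * Equiv.swap q r) < codeWeight v := by
  have hlt := hq.code_lt h hvex
  have hqr := hq.1
  unfold codeWeight
  simp only [hq.code_transition h hvex]
  have hmem : q ∈ univ.erase r := by simp [hqr.ne]
  rw [← add_sum_erase univ _ (mem_univ r), ← add_sum_erase _ _ hmem,
    ← add_sum_erase univ _ (mem_univ r), ← add_sum_erase _ _ hmem, swap_apply_left,
    swap_apply_right]
  have : ∑ x ∈ (univ.erase r).erase q, ((x : ℕ) + 1) * code v (Equiv.swap q r x) =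
      ∑ x ∈ (univ.erase r).erase q, ((x : ℕ) + 1) * code v x := by
    refine sum_congr rfl fun x hx => ?_
    rw [mem_erase, mem_erase] at hx
    rw [swap_apply_of_ne_of_ne hx.1 hx.2.1]
  rw [this]
  have h2 : (q : ℕ) < r := hqr
  nlinarith

/-! ### Differential operators of polynomials -/

theorem diffOp_eq_constr (f : MvPolynomial (Fin n) ℚ) :
    diffOp f = (MvPolynomial.basisMonomials (Fin n) ℚ).constr ℚ
      (fun m => partialMonomial (m : Fin n → ℕ)) f := by
  conv_rhs => rw [f.as_sum]
  rw [map_sum, diffOp]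
  refine sum_congr rfl fun m _ => ?_
  have : MvPolynomial.monomial m (coeff m f) =
      coeff m f • MvPolynomial.basisMonomials (Fin n) ℚ m := by
    rw [MvPolynomial.coe_basisMonomials, MvPolynomial.smul_monomial, smul_eq_mul, mul_one]
  rw [this, map_smul, Module.Basis.constr_basis]

theorem diffOp_add (f g : MvPolynomial (Fin n) ℚ) : diffOp (f + g) = diffOp f + diffOp g := by
  simp only [diffOp_eq_constr, map_add]

theorem diffOp_sum {ι : Type*} (s : Finset ι) (f : ι → MvPolynomial (Fin n) ℚ) :
    diffOp (∑ i ∈ s, f i) = ∑ i ∈ s, diffOp (f i) := by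
  simp only [diffOp_eq_constr, map_sum]

theorem diffOp_monomial (m : Fin n →₀ ℕ) (a : ℚ) :
    diffOp (MvPolynomial.monomial m a) = a • partialMonomial (m : Fin n → ℕ) := by
  have : MvPolynomial.monomial m a = a • MvPolynomial.basisMonomials (Fin n) ℚ m := by
    rw [MvPolynomial.coe_basisMonomials, MvPolynomial.smul_monomial, smul_eq_mul, mul_one]
  rw [diffOp_eq_constr, this, map_smul, Module.Basis.constr_basis]

theorem diffOp_one : diffOp (1 : MvPolynomial (Fin n) ℚ) = 1 := by
  have := diffOp_monomial (n := n) 0 1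
  rw [one_smul, Finsupp.coe_zero, partialMonomial_zero] at this
  exact this

theorem diffOp_X_mul (r : Fin n) (f p : MvPolynomial (Fin n) ℚ) :
    diffOp (X r * f) p = pderiv r (diffOp f p) := by
  induction f using MvPolynomial.induction_on' with
  | monomial m a =>
    have : (X r * MvPolynomial.monomial m a : MvPolynomial (Fin n) ℚ) =
        MvPolynomial.monomial (m + Finsupp.single r 1) a := by
      rw [mul_comm, MvPolynomial.X, MvPolynomial.monomial_mul, mul_one]
    rw [this, diffOp_monomial, diffOp_monomial, LinearMap.smul_apply, LinearMap.smul_apply,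
      Derivation.map_smul, ← partialMonomial_add_single, Finsupp.coe_add]
    congr 4
    funext i
    simp [Finsupp.single_apply, Pi.single_apply, eq_comm]
  | add f g hf hg =>
    rw [mul_add, diffOp_add, diffOp_add, LinearMap.add_apply, LinearMap.add_apply, map_add, hf, hg]

theorem toFin_X_mul (r : Fin n) (f : MvPolynomial ℕ ℚ) :
    toFin n (X (r : ℕ) * f) = X r * toFin n f := by
  unfold toFin
  rw [map_mul]
  congr 1
  have : (X (r : ℕ) : MvPolynomial ℕ ℚ) = rename Fin.val (X r) := by rw [MvPolynomial.rename_X]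
  rw [this, MvPolynomial.killCompl_rename_app]

/-- Both sides satisfy the transition recursion, with multiplication by `X r` on tableaux
corresponding to `∂/∂y_r`. -/
theorem codegPoly_of_vex {v : Perm (Fin n)} (hv : Vex v) :
    codegPoly v = diffOp (toFin n (tabPoly v)) (degPoly (longest n)) := by
  classical
  induction hm : codeWeight v using Nat.strong_induction_on generalizing v with
  | _ m ih =>
    by_cases h1 : v = 1
    · subst h1
      rw [codegPoly_one, tabPoly_one, toFin, map_one, diffOp_one, Module.End.one_apply]
    · obtain ⟨r, s, h⟩ := exists_isLastDescent h1
      rw [codegPoly_transition h, tabPoly_transition hv h,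
        ih _ (hm ▸ h.codeWeight_lt) (hv.swap h) rfl]
      have hadd : ∀ f g : MvPolynomial ℕ ℚ, toFin n (f + g) = toFin n f + toFin n g :=
        fun f g => map_add _ f g
      have hsum : ∀ (S : Finset (Fin n)) (f : Fin n → MvPolynomial ℕ ℚ),
          toFin n (∑ q ∈ S, f q) = ∑ q ∈ S, toFin n (f q) := fun S f => map_sum _ f S
      rw [hadd, toFin_X_mul, diffOp_add, LinearMap.add_apply, diffOp_X_mul, hsum, diffOp_sum,
        LinearMap.sum_apply]
      congr 1
      refine sum_congr rfl fun q hq => ?_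
      rw [mem_filter] at hq
      exact ih _ (hm ▸ hq.2.codeWeight_lt h hv) (hv.transition h hq.2) rfl

/-! ### Shapes and flags -/

/-- The positions with a nonzero code, by decreasing code. -/
def sortedPositions (v : Perm (Fin n)) : List (Fin n) :=
  ({p | 0 < code v p} : Finset (Fin n)).toList.insertionSort fun a b => code v b ≤ code v a

theorem sortedPositions_perm (v : Perm (Fin n)) :
    (sortedPositions v).Perm ({p | 0 < code v p} : Finset (Fin n)).toList :=
  List.perm_insertionSort _ _

theorem sortedPositions_pairwise (v : Perm (Fin n)) :
    (sortedPositions v).Pairwise fun a b => code v b ≤ code v a := by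
  have : Std.Total (fun a b : Fin n => code v b ≤ code v a) := ⟨fun a b => le_total _ _⟩
  have : IsTrans (Fin n) (fun a b : Fin n => code v b ≤ code v a) :=
    ⟨fun a b c h1 h2 => h2.trans h1⟩
  exact List.pairwise_insertionSort _ _

theorem coe_sortedPositions (v : Perm (Fin n)) :
    (sortedPositions v : Multiset (Fin n)) = ({p | 0 < code v p} : Finset (Fin n)).val := by
  rw [← Finset.coe_toList, Multiset.coe_eq_coe]
  exact sortedPositions_perm v

theorem shapeList_eq (v : Perm (Fin n)) : shapeList v = (sortedPositions v).map (code v) := by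
  refine List.Perm.eq_of_pairwise' (r := (· ≥ ·)) (Multiset.pairwise_sort _ _) ?_ ?_
  · rw [List.pairwise_map]
    exact sortedPositions_pairwise v
  · rw [← Multiset.coe_eq_coe, shapeList, Multiset.sort_eq, ← Multiset.map_coe,
      coe_sortedPositions, Multiset.filter_map]
    rfl

/-- The least element of `invSet v p`. -/
def minInv (v : Perm (Fin n)) (p : Fin n) : ℕ := sInf {k : ℕ | ∃ j ∈ invSet v p, (j : ℕ) = k}

theorem minInv_le {v : Perm (Fin n)} {p q : Fin n} (h : q ∈ invSet v p) : minInv v p ≤ q :=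
  Nat.sInf_le ⟨q, h, rfl⟩

theorem exists_eq_minInv {v : Perm (Fin n)} {p : Fin n} (h : (invSet v p).Nonempty) :
    ∃ q ∈ invSet v p, (q : ℕ) = minInv v p := by
  obtain ⟨q, hq⟩ := h
  exact Nat.sInf_mem (s := {k : ℕ | ∃ j ∈ invSet v p, (j : ℕ) = k}) ⟨q, q, hq, rfl⟩

theorem mem_sortedPositions {v : Perm (Fin n)} {p : Fin n} :
    p ∈ sortedPositions v ↔ 0 < code v p := by
  rw [(sortedPositions_perm v).mem_iff]
  simp

/-- Since the inversion sets are nested, ordering by decreasing code also orders their minima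
increasingly. Row lengths and flag bounds are thus indexed by the same list of positions. -/
theorem flag_eq {v : Perm (Fin n)} (hv : Vex v) : flag v = (sortedPositions v).map (minInv v) := by
  refine List.Perm.eq_of_pairwise' (r := (· ≤ ·)) (Multiset.pairwise_sort _ _) ?_ ?_
  · rw [List.pairwise_map]
    refine (sortedPositions_pairwise v).imp_of_mem fun {a b} _ hb hab => ?_
    rw [mem_sortedPositions, code_pos_iff] at hb
    obtain ⟨q, hq, hqm⟩ := exists_eq_minInv hb
    rw [← hqm]
    exact minInv_le (hv.invSet_subset hab hq)
  · rw [← Multiset.coe_eq_coe, flag, Multiset.sort_eq, ← Multiset.map_coe, coe_sortedPositions]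
    simp only [code_pos_iff]
    rfl

theorem lt_countP_iff {α : Type*} (f : α → ℕ) (j : ℕ) :
    ∀ (L : List α) (_ : L.Pairwise fun a b => f b ≤ f a) (i : ℕ),
      i < L.countP (fun a => j < f a) ↔ ∃ h : i < L.length, j < f L[i]
  | [], _, i => by simp
  | a :: L, hL, i => by
    rw [List.pairwise_cons] at hL
    have ih := lt_countP_iff f j L hL.2
    by_cases ha : j < f a
    · rw [List.countP_cons_of_pos (by simpa using ha)]
      cases i with
      | zero => simpa using ha
      | succ i => simpa using ih i
    · have h0 : (a :: L).countP (fun a => j < f a) = 0 := by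
        rw [List.countP_eq_zero]
        intro b hb
        rw [List.mem_cons] at hb
        rcases hb with rfl | hb
        · simpa using ha
        · have := hL.1 b hb
          simp; omega
      rw [h0]
      constructor
      · intro h; omega
      · rintro ⟨h, hj⟩
        cases i with
        | zero => exact absurd hj ha
        | succ i =>
          have h' : i < L.length := by simpa using h
          have := hL.1 L[i] (List.getElem_mem h')
          simp at hj
          omega

theorem lt_numGt_iff {v : Perm (Fin n)} {i j : ℕ} :
    i < numGt v j ↔ ∃ h : i < (sortedPositions v).length, j < code v (sortedPositions v)[i] := by
  rw [← lt_countP_iff _ _ _ (sortedPositions_pairwise v), (sortedPositions_perm v).countP_eq,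
    ← Multiset.coe_countP, Finset.coe_toList, Multiset.countP_eq_card_filter, ← Finset.filter_val,
    Finset.filter_filter]
  unfold numGt
  have : ({p | 0 < code v p ∧ j < code v p} : Finset (Fin n)) = ({p | j < code v p} : Finset _) := by
    ext p; simp; omega
  rw [this]
  rfl

theorem mem_shape_iff {v : Perm (Fin n)} {i j : ℕ} : (i, j) ∈ shape v ↔ i < numGt v j := by
  rw [lt_numGt_iff, shape, YoungDiagram.mem_ofRowLens]
  simp only [shapeList_eq, List.length_map, List.getElem_map]

/-- `IsTab` bounds a row by every inversion set of size at most its length. By nesting, the set of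
the row's own position implies all these bounds. The shift by one in `flaggedSet` turns `≤` into the
strict inequality of `IsTab`. -/
theorem isTab_iff_mem_flaggedSet {v : Perm (Fin n)} (hv : Vex v)
    (T : SemistandardYoungTableau (shape v)) :
    IsTab v (fun i j => T i j) ↔ T ∈ flaggedSet (shape v) (flag v) := by
  rw [flag_eq hv]
  constructor
  · intro hT i j hij
    rw [mem_shape_iff] at hij
    obtain ⟨h, hj⟩ := lt_numGt_iff.mp hij
    rw [List.getD_eq_getElem _ _ (by simpa using h), List.getElem_map]
    obtain ⟨q, hq, hqm⟩ := exists_eq_minInv (code_pos_iff.mp ((Nat.zero_le j).trans_lt hj))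
    rw [← hqm]
    exact hT.flag _ q i j hq hij (lt_numGt_iff.mpr ⟨h, by omega⟩)
  · intro hT
    refine ⟨fun i j hij => T.zeros (by rw [mem_shape_iff]; omega),
      fun i j j' hjj hi => T.row_weak hjj (mem_shape_iff.mpr hi),
      fun i i' j hii hi => T.col_strict hii (mem_shape_iff.mpr hi), ?_⟩
    intro p q i j hq hi hi'
    have := hT i j (mem_shape_iff.mpr hi)
    obtain ⟨h, hj⟩ := lt_numGt_iff.mp hi'
    rw [List.getD_eq_getElem _ _ (by simpa using h), List.getElem_map] at this
    have h2 := minInv_le (hv.invSet_subset (show code v p ≤ code v (sortedPositions v)[i] by omega) hq)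
    omega

theorem flaggedSchur_eq_tabPoly {v : Perm (Fin n)} (hv : Vex v) :
    flaggedSchur (shape v) (flag v) = tabPoly v := by
  have hcells : (shape v).cells = cells v := by
    ext ⟨i, j⟩
    rw [YoungDiagram.mem_cells, mem_shape_iff, mem_cells]
  unfold flaggedSchur tabPoly
  rw [hcells]
  refine Finset.sum_bij (fun T _ i j => T i j) ?_ ?_ ?_ ?_
  · intro T hT
    rw [Set.Finite.mem_toFinset] at hT ⊢
    exact (isTab_iff_mem_flaggedSet hv T).mpr hT
  · intro T _ T' _ h
    ext i j
    exact congrFun (congrFun h i) j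
  · intro T hT
    rw [Set.Finite.mem_toFinset] at hT
    let S : SemistandardYoungTableau (shape v) :=
      { entry := T
        row_weak' := fun {i j j'} hj h => IsTab.row hT i j j' hj (mem_shape_iff.mp h)
        col_strict' := fun {i i' j} hi h => IsTab.col hT i i' j hi (mem_shape_iff.mp h)
        zeros' := fun {i j} h => IsTab.zero hT i j (by rw [mem_shape_iff] at h; omega) }
    refine ⟨S, ?_, rfl⟩
    rw [Set.Finite.mem_toFinset]
    exact (isTab_iff_mem_flaggedSet hv S).mp hT
  · intro T _
    rfl

/-! ### Pattern avoidance -/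

theorem longest_mul_longest_mul (w : Perm (Fin n)) : longest n * (longest n * w) = w := by
  ext i; simp [longest]

theorem isVexillary_longest_mul {w : Perm (Fin n)} (hw : Avoids w ![3, 4, 1, 2]) :
    IsVexillary (longest n * w) := by
  rintro ⟨f, hf⟩
  refine hw ⟨f, fun a b => ?_⟩
  have := hf b a
  rw [longest_lt] at this
  rw [this]
  fin_cases a <;> fin_cases b <;> decide

theorem vex_longest_mul {w : Perm (Fin n)} (hw : Avoids w ![3, 4, 1, 2]) :
    Vex (longest n * w) := by
  rintro a b c d hab hbc hcd ⟨h1, h2, h3⟩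
  rw [longest_lt] at h1 h2 h3
  refine hw ⟨OrderEmbedding.ofStrictMono ![a, b, c, d] ?_, ?_⟩
  · rw [Fin.strictMono_iff_lt_succ]
    intro i
    fin_cases i <;> assumption
  · intro x y
    rw [OrderEmbedding.coe_ofStrictMono]
    fin_cases x <;> fin_cases y <;> simp <;> omega

theorem dominant_longest_mul {w : Perm (Fin n)} (hw : Avoids w ![3, 1, 2]) :
    Dominant (longest n * w) := by
  rintro a b c hab hbc ⟨h1, h2⟩
  rw [longest_lt] at h1 h2
  refine hw ⟨OrderEmbedding.ofStrictMono ![a, b, c] ?_, ?_⟩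
  · rw [Fin.strictMono_iff_lt_succ]
    intro i
    fin_cases i <;> assumption
  · intro x y
    rw [OrderEmbedding.coe_ofStrictMono]
    fin_cases x <;> fin_cases y <;> simp <;> omega

end DegPoly

end

theorem mainTheorem7 (n : ℕ) (w : Equiv.Perm (Fin n)) :
    (DegPoly.Avoids w ![3, 4, 1, 2] →
      DegPoly.IsVexillary (DegPoly.longest n * w) ∧
      DegPoly.degPoly w =
        MvPolynomial.C (1 / DegPoly.factProd n) *
          DegPoly.diffOp
            (DegPoly.toFin n
              (DegPoly.flaggedSchur (DegPoly.shape (DegPoly.longest n * w))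
                (DegPoly.flag (DegPoly.longest n * w))))
            (DegPoly.vandermondeProd n)) ∧
    (DegPoly.Avoids w ![3, 1, 2] →
      DegPoly.degPoly w =
        MvPolynomial.C (1 / DegPoly.factProd n) *
          DegPoly.partialMonomial (DegPoly.code (DegPoly.longest n * w))
            (DegPoly.vandermondeProd n) ∧
      DegPoly.degPoly w =
        Matrix.det (Matrix.of fun i j : Fin n =>
          DegPoly.divPow (MvPolynomial.X i)
            ((n : ℤ) - (DegPoly.code (DegPoly.longest n * w) i : ℤ) - ((j : ℕ) + 1 : ℤ)))) := by
  -- Every differential operator used is linear, so the scalar relating `degPoly (longest n)` to the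
  -- Vandermonde product can be taken out.
  have hlin : ∀ L : Module.End ℚ (MvPolynomial (Fin n) ℚ),
      L (DegPoly.degPoly (DegPoly.longest n)) =
        MvPolynomial.C (1 / DegPoly.factProd n) * L (DegPoly.vandermondeProd n) := by
    intro L
    rw [DegPoly.degPoly_longest, DegPoly.divVandermonde_eq, ← MvPolynomial.smul_eq_C_mul, map_smul,
      MvPolynomial.smul_eq_C_mul]
  have hco : DegPoly.degPoly w = DegPoly.codegPoly (DegPoly.longest n * w) := by
    rw [DegPoly.codegPoly, DegPoly.longest_mul_longest_mul]
  refine ⟨fun hw => ⟨DegPoly.isVexillary_longest_mul hw, ?_⟩, fun hw => ⟨?_, ?_⟩⟩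
  · have hv := DegPoly.vex_longest_mul hw
    rw [hco, DegPoly.codegPoly_of_vex hv, DegPoly.flaggedSchur_eq_tabPoly hv, hlin]
  · rw [hco, DegPoly.codegPoly_of_dominant (DegPoly.dominant_longest_mul hw), hlin]
  · rw [hco, DegPoly.codegPoly_of_dominant (DegPoly.dominant_longest_mul hw),
      DegPoly.degPoly_longest, DegPoly.divVandermonde, DegPoly.partialMonomial_det_divPow]
    congr 2
    funext i j
    congr 1
    ring
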